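/- On the region $r>0$, $0<\theta<\pi$ with coordinates $(r,\theta,\phi,\psi)$ let $V=1+\frac1r$ and let $$g=V\bigl(dr^2+r^2(d\theta^2+\sin^2\theta\,d\phi^2)\bigr)+V^{-1}(d\psi+\cos\theta\,d\phi)^2$$ be the Taub-NUT metric. Let $\tau_j$ be the Pauli matrices, $\mathbf t_j=\frac i2\tau_j$, and put $$\eta_1=-\sin\psi\,d\theta+\sin\theta\cos\psi\,d\phi,\quad \eta_2=\cos\psi\,d\theta+\sin\theta\sin\psi\,d\phi,\quad \eta_3=d\psi+\cos\theta\,d\phi,$$ $$e_0=\sqrt V\,dr,\quad e_1=r\sqrt V\,\eta_1,\quad e_2=r\sqrt V\,\eta_2,\quad e_3=\tfrac1{\sqrt V}\,\eta_3,\qquad \Sigma_i=e_0\wedge e_i+\tfrac12\varepsilon_{ijk}\,e_j\wedge e_k .$$ 1. The tetrad is orthonormal, $g=\sum_a e_a^2$, and $SU(2)$-invariant: with $h=e^{\phi\mathbf t_3}e^{\theta\mathbf t_2}e^{\psi\mathbf t_3}\in SU(2)$ one has $h^{-1}dh=\sum_j\eta_j\,\mathbf t_j$, so the $\eta_j$ are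 left-invariant one-forms. 2. There is exactly one antisymmetric matrix of one-forms $(\gamma_{ij})$ on the region (the self-dual spin connection in this gauge) with $d\Sigma_i+\gamma_{ij}\wedge\Sigma_j=0$. Let $A=\frac12\varepsilon_{ijk}\gamma_{jk}\otimes\mathbf t_i$. Its contraction with $\partial/\partial\phi$ is $A_\phi=\sum_j f_j(r)\,n_j\,\mathbf t_j$, where $\mathbf n=(\sin\theta\cos\psi,\sin\theta\sin\psi,\cos\theta)$ and $$f_1=f_2=-\frac{r}{r+1},\qquad f_3=\frac{r(r+2)}{(r+1)^2}.$$ Its holonomy $\mathcal P\exp\bigl(-\int_0^{2\pi}A_\phi\,d\phi\bigr)$, that is, $\Psi(2\pi)$ for the solution on $0\le\phi\le2\pi$ of $\partial_\phi\Psi=-A_\phi\Psi$, $\Psi(0)=\mathbf 1$, is the Skyrme field $$U(r,\theta,\psi)=\exp\Bigl(-i\pi\sum_{j=1}^3 f_j(r)\,n_j\,\tau_j\Bigr).$$ 3. $U$ takes values in $SU(2)$ and is smooth on $\mathcal B=\{(r,\theta,\psi): r>0,\ 0<\theta<\pi,\ 0<\psi<4\pi\}$, the three-form $\mathrm{Tr}\bigl((U^{-1}dU)^3\bigr)$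 is integrable on $\mathcal B$, and, with $\mathcal B$ oriented by $dr\wedge d\theta\wedge d\psi$, the topological degree of $U$ is $$D=-\frac1{24\pi^2}\int_{\mathcal B}\mathrm{Tr}\bigl((U^{-1}dU)^3\bigr)=2 .$$ -/

import Mathlib

namespace TaubNUT

noncomputable section

/-! ### Coordinates and differential forms

Coordinates on the Taub-NUT manifold are `x = (r, θ, φ, ψ)`; the space of orbits of `∂/∂φ` has the
coordinates `q = (r, θ, ψ)`. -/

/-- The coordinate space of `(r, θ, φ, ψ)`. -/
abbrev Coord4 : Type := Fin 4 → ℝ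

/-- The coordinate space of `(r, θ, ψ)`. -/
abbrev Coord3 : Type := Fin 3 → ℝ

/-- The domain `r > 0`, `0 < θ < π` of the coordinates `(r, θ, φ, ψ)`. -/
def chart : Set Coord4 := {x | 0 < x 0 ∧ 0 < x 1 ∧ x 1 < Real.pi}

/-- The coordinate domain `r > 0`, `0 < θ < π`, `0 < ψ < 4π` of the space of orbits. -/
def orbitSpace : Set Coord3 :=
  {q | 0 < q 0 ∧ (0 < q 1 ∧ q 1 < Real.pi) ∧ 0 < q 2 ∧ q 2 < 4 * Real.pi}

/-- A one-form at a point. -/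
abbrev Covector : Type := Coord4 →L[ℝ] ℝ

/-- The coordinate differentials `dr, dθ, dφ, dψ`. -/
def dx (k : Fin 4) : Covector := ContinuousLinearMap.proj k

/-- The coordinate vector fields. -/
def partialVec {n : ℕ} (k : Fin n) : Fin n → ℝ := Pi.single k 1

/-- A one-form as an alternating form of degree one. -/
def toForm (α : Covector) : Coord4 [⋀^Fin 1]→L[ℝ] ℝ :=
  ContinuousAlternatingMap.ofSubsingleton ℝ Coord4 ℝ (0 : Fin 1) α

/-- The wedge product of a one-form with an `n`-form,
`(α ∧ ω)(v₀, …, vₙ) = ∑ᵢ (-1)ⁱ α(vᵢ) ω(v₀, …, v̂ᵢ, …, vₙ)`. -/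
def wedge {n : ℕ} (α : Covector) (ω : Coord4 [⋀^Fin n]→L[ℝ] ℝ) :
    Coord4 [⋀^Fin (n + 1)]→L[ℝ] ℝ :=
  ContinuousAlternatingMap.alternatizeUncurryFin (ContinuousLinearMap.smulRight α ω)

/-- The totally antisymmetric symbol on three indices, `ε₀₁₂ = 1`. -/
def levi (i j k : Fin 3) : ℝ :=
  (((j : ℕ) : ℝ) - ((i : ℕ) : ℝ)) * (((k : ℕ) : ℝ) - ((i : ℕ) : ℝ))
    * (((k : ℕ) : ℝ) - ((j : ℕ) : ℝ)) / 2

/-! ### The Taub-NUT metric and its invariant tetrad -/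

/-- The potential `V = 1 + 1/r`. -/
def potV (x : Coord4) : ℝ := 1 + 1 / x 0

/-- The quadratic form of the Taub-NUT metric
`V (dr² + r² (dθ² + sin² θ dφ²)) + V⁻¹ (dψ + cos θ dφ)²`. -/
def metric (x v : Coord4) : ℝ :=
  potV x * (v 0 ^ 2 + x 0 ^ 2 * (v 1 ^ 2 + Real.sin (x 1) ^ 2 * v 2 ^ 2))
    + (potV x)⁻¹ * (v 3 + Real.cos (x 1) * v 2) ^ 2

/-- The one-forms `η₁, η₂, η₃`. -/
def eta (j : Fin 3) (x : Coord4) : Covector :=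
  ![-Real.sin (x 3) • dx 1 + (Real.sin (x 1) * Real.cos (x 3)) • dx 2,
    Real.cos (x 3) • dx 1 + (Real.sin (x 1) * Real.sin (x 3)) • dx 2,
    dx 3 + Real.cos (x 1) • dx 2] j

/-- The tetrad `e₀ = √V dr`, `e₁ = r √V η₁`, `e₂ = r √V η₂`, `e₃ = η₃ / √V`. -/
def tetrad (a : Fin 4) (x : Coord4) : Covector :=
  ![Real.sqrt (potV x) • dx 0,
    (x 0 * Real.sqrt (potV x)) • eta 0 x,
    (x 0 * Real.sqrt (potV x)) • eta 1 x,
    (1 / Real.sqrt (potV x)) • eta 2 x] a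

/-- The self-dual two-forms `Σᵢ = e₀ ∧ eᵢ + ½ ∑ⱼₖ εᵢⱼₖ eⱼ ∧ eₖ` of the tetrad. -/
def selfDualForm (i : Fin 3) (x : Coord4) : Coord4 [⋀^Fin 2]→L[ℝ] ℝ :=
  wedge (tetrad 0 x) (toForm (tetrad i.succ x))
    + (1 / 2 : ℝ) • ∑ j : Fin 3, ∑ k : Fin 3,
        levi i j k • wedge (tetrad j.succ x) (toForm (tetrad k.succ x))

/-- `γ` is the matrix of coefficients, in the given tetrad, of the self-dual spin connection:
`γᵢⱼ = -γⱼᵢ` and `dΣᵢ + ∑ⱼ γᵢⱼ ∧ Σⱼ = 0`. -/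
structure IsSelfDualSpinConnection (γ : Fin 3 → Fin 3 → Coord4 → Covector) : Prop where
  antisymm : ∀ x ∈ chart, ∀ i j, γ i j x = -γ j i x
  cartan : ∀ x ∈ chart, ∀ i,
    extDeriv (selfDualForm i) x + ∑ j, wedge (γ i j x) (selfDualForm j x) = 0

/-! ### The gauge potential and its holonomy -/

/-- The Pauli matrices. -/
def pauli (j : Fin 3) : Matrix (Fin 2) (Fin 2) ℂ :=
  ![!![0, 1; 1, 0], !![0, -Complex.I; Complex.I, 0], !![1, 0; 0, -1]] j

/-- The generators `tⱼ = (i/2) τⱼ` of `su(2)`. -/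
def gen (j : Fin 3) : Matrix (Fin 2) (Fin 2) ℂ := (Complex.I / 2) • pauli j

/-- The components `Aᵢ = ½ ∑ⱼₖ εᵢⱼₖ γⱼₖ` of the Yang-Mills potential. -/
def potentialComponent (γ : Fin 3 → Fin 3 → Coord4 → Covector) (i : Fin 3) (x : Coord4) :
    Covector :=
  (1 / 2 : ℝ) • ∑ j, ∑ k, levi i j k • γ j k x

/-- The Yang-Mills potential `A = ∑ᵢ Aᵢ ⊗ tᵢ`, evaluated at `x` on the vector `v`. -/
def potential (γ : Fin 3 → Fin 3 → Coord4 → Covector) (x v : Coord4) :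
    Matrix (Fin 2) (Fin 2) ℂ :=
  ∑ i, ((potentialComponent γ i x v : ℝ) : ℂ) • gen i

/-- The Euler angle parametrisation `exp(φ t₃) exp(θ t₂) exp(ψ t₃)` of `SU(2)`. -/
def eulerMap (x : Coord4) : Matrix (Fin 2) (Fin 2) ℂ :=
  NormedSpace.exp (((x 2 : ℝ) : ℂ) • gen 2) * NormedSpace.exp (((x 1 : ℝ) : ℂ) • gen 1)
    * NormedSpace.exp (((x 3 : ℝ) : ℂ) • gen 2)

/-- The point with coordinate `φ = s` on the orbit labelled by `q = (r, θ, ψ)`. -/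
def orbitPoint (q : Coord3) (s : ℝ) : Coord4 := ![q 0, q 1, s, q 2]

/-- `Ψ` is the parallel transport of `A` along the orbit `q` of `∂/∂φ`, `0 ≤ φ ≤ 2π`:
`∂Ψ/∂φ = -A_φ Ψ` and `Ψ(0) = 1` (entry by entry). -/
structure IsTransport (A : Coord4 → Coord4 → Matrix (Fin 2) (Fin 2) ℂ) (q : Coord3)
    (Ψ : ℝ → Matrix (Fin 2) (Fin 2) ℂ) : Prop where
  init : Ψ 0 = 1
  ode : ∀ s ∈ Set.Icc 0 (2 * Real.pi), ∀ a b,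
    HasDerivWithinAt (fun t => Ψ t a b)
      ((-(A (orbitPoint q s) (partialVec 2)) * Ψ s) a b) (Set.Icc 0 (2 * Real.pi)) s

/-- `W = P exp(-∫₀^{2π} A_φ dφ)` along the orbit `q`. -/
def IsHolonomy (A : Coord4 → Coord4 → Matrix (Fin 2) (Fin 2) ℂ) (q : Coord3)
    (W : Matrix (Fin 2) (Fin 2) ℂ) : Prop :=
  (∃ Ψ, IsTransport A q Ψ) ∧ ∀ Ψ, IsTransport A q Ψ → Ψ (2 * Real.pi) = W

/-! ### The Skyrme field and its topological degree -/

/-- The functions `f₁ = f₂ = -r/(r+1)` and `f₃ = r(r+2)/(r+1)²`. -/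
def profile (j : Fin 3) (r : ℝ) : ℝ :=
  ![-r / (r + 1), -r / (r + 1), r * (r + 2) / (r + 1) ^ 2] j

/-- The unit vector `n = (sin θ cos ψ, sin θ sin ψ, cos θ)`. -/
def unitVec (j : Fin 3) (θ ψ : ℝ) : ℝ :=
  ![Real.sin θ * Real.cos ψ, Real.sin θ * Real.sin ψ, Real.cos θ] j

/-- The Taub-NUT Skyrme field `U = exp(-iπ ∑ⱼ fⱼ(r) nⱼ(θ, ψ) τⱼ)`. -/
def skyrmeField (q : Coord3) : Matrix (Fin 2) (Fin 2) ℂ :=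
  NormedSpace.exp ((-(Complex.I * (Real.pi : ℂ))) •
    ∑ j, ((profile j (q 0) * unitVec j (q 1) (q 2) : ℝ) : ℂ) • pauli j)

/-- The coefficient `U⁻¹ ∂ₖU` of `U⁻¹ dU`. -/
def leftCurrent (U : Coord3 → Matrix (Fin 2) (Fin 2) ℂ) (k : Fin 3) (q : Coord3) :
    Matrix (Fin 2) (Fin 2) ℂ :=
  (U q)⁻¹ * Matrix.of fun a b => lineDeriv ℝ (fun p => U p a b) q (partialVec k)

/-- The coefficient of `dr ∧ dθ ∧ dψ` in the three-form `Tr((U⁻¹ dU)³)`. -/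
def traceCube (U : Coord3 → Matrix (Fin 2) (Fin 2) ℂ) (q : Coord3) : ℂ :=
  ∑ σ : Equiv.Perm (Fin 3), ((Equiv.Perm.sign σ : ℤ) : ℂ) *
    Matrix.trace (leftCurrent U (σ 0) q * leftCurrent U (σ 1) q * leftCurrent U (σ 2) q)

/-- The degree `D = -(1/24π²) ∫ Tr((U⁻¹ dU)³)` over the space of orbits, oriented by
`dr ∧ dθ ∧ dψ`. -/
def degree (U : Coord3 → Matrix (Fin 2) (Fin 2) ℂ) : ℂ :=
  -(1 / (24 * (Real.pi : ℂ) ^ 2)) * ∫ q in orbitSpace, traceCube U q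

end

end TaubNUT

/-! The geometric half rests on the Maurer-Cartan equations `dηᵢ = ηᵢ₊₁ ∧ ηᵢ₊₂` (indices mod 3). In
the invariant coframe `Σᵢ = ρᵢ dr ∧ ηᵢ + αᵢ ηᵢ₊₁ ∧ ηᵢ₊₂`, with `ρ = (r+1, r+1, 1)` and `α = (r, r,
r(r+1))`. Hence `dΣᵢ = (αᵢ' - ρᵢ) dr ∧ ηᵢ₊₁ ∧ ηᵢ₊₂`, and the ansatz `γᵢⱼ = εᵢⱼₖ fₖ ηₖ` reduces the
Cartan equation to `fᵢ₊₁ ρᵢ₊₂ + fᵢ₊₂ ρᵢ₊₁ = ρᵢ - αᵢ'`, whose solution is the stated profile.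
Uniqueness is pointwise linear algebra (`eq_zero_of_wedge_selfDual`). Since `A_φ` does not depend on
`φ`, the path-ordered exponential is the ordinary exponential `exp(-2π A_φ)`
(`isHolonomy_of_const`).

For the degree, put `s = r/(r+1)`. Then `f₁ = f₂ = -s`, `f₃ = s(2-s)`, and the vector `F = (fⱼ nⱼ)`
has length `ρ = s κ(s, θ)` with `κ > 0`. So `U` is the point of `S³` at distance `πρ` from the
identity in the direction `-F/ρ`, which rotates with `ψ`. With `(n₁, n₂)` the meridian components of
this direction and `ω` the differential of its meridian angle, `Tr((U⁻¹dU)³)` is `-12π sin²(πρ) dρ ∧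
n₁ω ∧ dψ` (`traceCube_of_axial`, `traceCube_skyrmeField`).

The form `n₁ω` is closed, so `sin²(πρ) dρ ∧ n₁ω = d(G(ρ) n₁ω)` with `G' = sin²(πρ)`, `G(0) = 0`.
Stokes on the box `0 ≤ s ≤ 1`, `0 ≤ θ ≤ π`, `0 ≤ ψ ≤ 4π` leaves only the face `s = 1`, where `κ = 1`
and `G(1) = 1/2`. It contributes `4π ∫ (sin θ)/2 dθ = 4π` (`integral_degreeDensity`), so the degree
is `12π · 4π / (24π²) = 2`. The value is 2 rather than 1 because `ψ` runs over twice the period of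
the target angle. -/

namespace TaubNUT

open MeasureTheory

/-! ### Exponentials in `SU(2)`, the metric and the Euler angles -/

open Complex in
/-- Euler's formula for a matrix squaring to `-1`. -/
theorem exp_smul_of_mul_self_eq_neg_one {J : Matrix (Fin 2) (Fin 2) ℂ} (hJ : J * J = -1) (t : ℝ) :
    NormedSpace.exp ((t : ℂ) • J)
      = ((Real.cos t : ℝ) : ℂ) • (1 : Matrix (Fin 2) (Fin 2) ℂ) + ((Real.sin t : ℝ) : ℂ) • J := by
  let _ : NormedRing (Matrix (Fin 2) (Fin 2) ℂ) := Matrix.linftyOpNormedRing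
  let _ : NormedAlgebra ℂ (Matrix (Fin 2) (Fin 2) ℂ) := Matrix.linftyOpNormedAlgebra
  let _ : NormedAlgebra ℝ (Matrix (Fin 2) (Fin 2) ℂ) := NormedAlgebra.restrictScalars ℝ ℂ _
  let _ : NormedAlgebra ℚ ℂ := NormedAlgebra.restrictScalars ℚ ℝ ℂ
  let _ : NormedAlgebra ℚ (Matrix (Fin 2) (Fin 2) ℂ) := NormedAlgebra.restrictScalars ℚ ℝ _
  -- `J² = -1` makes `a + bi ↦ a + bJ` a real algebra homomorphism; being continuous, it carries
  -- `exp(it)` to `exp(tJ)`.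
  have hval : ∀ z : ℂ, Complex.liftAux J hJ z
      = ((z.re : ℝ) : ℂ) • (1 : Matrix (Fin 2) (Fin 2) ℂ) + ((z.im : ℝ) : ℂ) • J := by
    intro z
    rw [Complex.liftAux_apply, Algebra.algebraMap_eq_smul_one]
    rfl
  have hc : Continuous (Complex.liftAux J hJ) := by
    have h : (Complex.liftAux J hJ : ℂ → Matrix (Fin 2) (Fin 2) ℂ)
        = fun z => ((z.re : ℝ) : ℂ) • (1 : Matrix (Fin 2) (Fin 2) ℂ) + ((z.im : ℝ) : ℂ) • J :=
      funext hval
    rw [h]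
    fun_prop
  have h := NormedSpace.map_exp (Complex.liftAux J hJ) hc (t * I)
  rw [← Complex.exp_eq_exp_ℂ, hval, hval] at h
  rw [Complex.exp_ofReal_mul_I_re, Complex.exp_ofReal_mul_I_im, re_ofReal_mul, im_ofReal_mul, I_re,
    I_im, mul_zero, mul_one, ofReal_zero, zero_smul, zero_add] at h
  exact h.symm

theorem exp_smul_gen (t : ℝ) (j : Fin 3) :
    NormedSpace.exp ((t : ℂ) • gen j) = ((Real.cos (t / 2) : ℝ) : ℂ) • (1 : Matrix (Fin 2) (Fin 2) ℂ)
      + ((Real.sin (t / 2) : ℝ) : ℂ) • (Complex.I • pauli j) := by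
  rw [← exp_smul_of_mul_self_eq_neg_one _ (t / 2)]
  · rw [gen, smul_smul, smul_smul]
    congr 2
    push_cast
    ring
  · ext a b
    fin_cases j <;> fin_cases a <;> fin_cases b <;> simp [pauli]

theorem sum_tetrad_sq {x : Coord4} (hx : x ∈ chart) (v : Coord4) :
    ∑ a, (tetrad a x v) ^ 2 = metric x v := by
  obtain ⟨hr, -, -⟩ := hx
  have hV : 0 < potV x := by unfold potV; positivity
  have hs : Real.sqrt (potV x) ^ 2 = potV x := Real.sq_sqrt hV.le
  have h1 := Real.sin_sq_add_cos_sq (x 3)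
  simp only [Fin.sum_univ_four, tetrad, eta, metric, dx, Matrix.cons_val, Matrix.cons_val_zero,
    Matrix.cons_val_one, smul_apply, add_apply,
    ContinuousLinearMap.proj_apply, smul_eq_mul, mul_pow, hs, div_pow, one_pow]
  linear_combination (potV x * x 0 ^ 2 * (v 1 ^ 2 + Real.sin (x 1) ^ 2 * v 2 ^ 2)) * h1

/-- The phase `exp(i xₖ / 2)`. -/
noncomputable def phase (x : Coord4) (k : Fin 4) : ℂ :=
  (Real.cos (x k / 2) : ℝ) + Complex.I * (Real.sin (x k / 2) : ℝ)

/-- The phase `exp(-i xₖ / 2)`. -/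
noncomputable def phaseInv (x : Coord4) (k : Fin 4) : ℂ :=
  (Real.cos (x k / 2) : ℝ) - Complex.I * (Real.sin (x k / 2) : ℝ)

/-- This is `dh = h ∑ ηⱼ tⱼ`, tested along straight lines. In half-angle phases every entry of `h`
is a monomial, so the identity only needs the phases to have modulus one and `sin² + cos² = 1`. -/
theorem hasDerivAt_eulerMap (x v : Coord4) (a b : Fin 2) :
    HasDerivAt (fun s : ℝ => eulerMap (x + s • v) a b)
      ((eulerMap x * ∑ j, ((eta j x v : ℝ) : ℂ) • gen j) a b) 0 := by
  have ha : ∀ k, HasDerivAt (fun s : ℝ => (x + s • v) k / 2) (v k / 2) 0 := fun k => by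
    simpa using (((hasDerivAt_id (0 : ℝ)).mul_const (v k)).const_add (x k)).div_const 2
  have hs : ∀ k, HasDerivAt (fun s : ℝ => ((Real.sin ((x + s • v) k / 2) : ℝ) : ℂ))
      ((Real.cos (x k / 2) : ℝ) * (v k / 2)) 0 := fun k => by
    simpa using (ha k).sin.ofReal_comp
  have hc : ∀ k, HasDerivAt (fun s : ℝ => ((Real.cos ((x + s • v) k / 2) : ℝ) : ℂ))
      (-(Real.sin (x k / 2) : ℝ) * (v k / 2)) 0 := fun k => by
    simpa using (ha k).cos.ofReal_comp
  have hp : ∀ k, HasDerivAt (fun s : ℝ => phase (x + s • v) k)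
      (phase x k * (Complex.I * (v k / 2))) 0 := fun k =>
    ((hc k).add ((hs k).const_mul Complex.I)).congr_deriv (by
      linear_combination (norm := (unfold phase; ring))
        -(Real.sin (x k / 2) : ℝ) * ((v k : ℂ) / 2) * Complex.I_sq)
  have hp' : ∀ k, HasDerivAt (fun s : ℝ => phaseInv (x + s • v) k)
      (phaseInv x k * (-Complex.I * (v k / 2))) 0 := fun k =>
    ((hc k).sub ((hs k).const_mul Complex.I)).congr_deriv (by
      linear_combination (norm := (unfold phaseInv; ring))
        -(Real.sin (x k / 2) : ℝ) * ((v k : ℂ) / 2) * Complex.I_sq)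
  have h1 : ∀ k, ((Real.sin (x k / 2) : ℝ) : ℂ) ^ 2 + ((Real.cos (x k / 2) : ℝ) : ℂ) ^ 2 = 1 :=
    fun k => by exact_mod_cast Real.sin_sq_add_cos_sq (x k / 2)
  have hs2 : ∀ k, ((Real.sin (x k) : ℝ) : ℂ)
      = 2 * (Real.sin (x k / 2) : ℝ) * (Real.cos (x k / 2) : ℝ) := fun k => by
    rw [show x k = 2 * (x k / 2) by ring, Real.sin_two_mul]; push_cast; ring_nf
  have hc2 : ∀ k, ((Real.cos (x k) : ℝ) : ℂ)
      = (Real.cos (x k / 2) : ℝ) ^ 2 - (Real.sin (x k / 2) : ℝ) ^ 2 := fun k => by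
    rw [show x k = 2 * (x k / 2) by ring, Real.cos_two_mul']; push_cast; ring_nf
  have hinv : phase x 3 * phaseInv x 3 = 1 := by
    unfold phase phaseInv
    linear_combination h1 3 - ((Real.sin (x 3 / 2) : ℝ) : ℂ) ^ 2 * Complex.I_sq
  have e2 : ((eta 2 x v : ℝ) : ℂ) = v 3
      + ((Real.cos (x 1 / 2) : ℝ) ^ 2 - (Real.sin (x 1 / 2) : ℝ) ^ 2) * v 2 := by
    rw [← hc2]; simp [eta, dx]
  have e0 : ((eta 0 x v : ℝ) : ℂ) = -(Real.sin (x 3) : ℝ) * v 1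
      + (Real.sin (x 1) : ℝ) * (Real.cos (x 3) : ℝ) * v 2 := by simp [eta, dx]
  have e1 : ((eta 1 x v : ℝ) : ℂ) = (Real.cos (x 3) : ℝ) * v 1
      + (Real.sin (x 1) : ℝ) * (Real.sin (x 3) : ℝ) * v 2 := by simp [eta, dx]
  -- The off-diagonal entries of `∑ ηⱼ tⱼ` depend on `ψ` only through the factors `exp(±iψ)`.
  have ep : Complex.I / 2 * (eta 0 x v : ℝ) - (eta 1 x v : ℝ) / 2 = phase x 3 ^ 2 * (-(v 1 / 2)
      + Complex.I * (Real.sin (x 1 / 2) : ℝ) * (Real.cos (x 1 / 2) : ℝ) * v 2) := by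
    rw [e0, e1, hs2 1, hs2 3, hc2 3, phase]
    ring_nf
    simp only [Complex.I_sq, Complex.I_pow_three]
    ring
  have em : Complex.I / 2 * (eta 0 x v : ℝ) + (eta 1 x v : ℝ) / 2 = phaseInv x 3 ^ 2 * ((v 1 / 2)
      + Complex.I * (Real.sin (x 1 / 2) : ℝ) * (Real.cos (x 1 / 2) : ℝ) * v 2) := by
    rw [e0, e1, hs2 1, hs2 3, hc2 3, phaseInv]
    ring_nf
    simp only [Complex.I_sq, Complex.I_pow_three]
    ring
  have hE : ∀ y : Coord4, eulerMap y =
      !![phase y 2 * (Real.cos (y 1 / 2) : ℝ) * phase y 3,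
        phase y 2 * (Real.sin (y 1 / 2) : ℝ) * phaseInv y 3;
        -(phaseInv y 2 * (Real.sin (y 1 / 2) : ℝ) * phase y 3),
        phaseInv y 2 * (Real.cos (y 1 / 2) : ℝ) * phaseInv y 3] := by
    intro y
    rw [eulerMap, exp_smul_gen, exp_smul_gen, exp_smul_gen]
    ext i j
    fin_cases i <;> fin_cases j <;>
      simp [pauli, Matrix.mul_apply, Fin.sum_univ_two, phase, phaseInv] <;> ring_nf
  have hsum : ∑ j, ((eta j x v : ℝ) : ℂ) • gen j =
      !![Complex.I / 2 * (eta 2 x v : ℝ),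
        Complex.I / 2 * (eta 0 x v : ℝ) + (eta 1 x v : ℝ) / 2;
        Complex.I / 2 * (eta 0 x v : ℝ) - (eta 1 x v : ℝ) / 2,
        -(Complex.I / 2 * (eta 2 x v : ℝ))] := by
    ext i j
    fin_cases i <;> fin_cases j <;>
      simp [gen, pauli, Fin.sum_univ_three] <;> ring_nf <;> simp <;> ring
  rw [hsum, ep, em, e2, hE]
  simp only [hE]
  set c := ((Real.cos (x 1 / 2) : ℝ) : ℂ) with hcd
  set s := ((Real.sin (x 1 / 2) : ℝ) : ℂ) with hsd
  have h11 : s ^ 2 + c ^ 2 = 1 := h1 1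
  fin_cases a <;> fin_cases b
  · refine (((hp 2).mul (hc 1)).mul (hp 3)).congr_deriv ?_
    simp only [Matrix.mul_apply, Fin.sum_univ_two, Matrix.of_apply, Matrix.cons_val, Fin.zero_eta,
      Fin.mk_one, Pi.mul_apply, zero_smul, add_zero, ← hcd, ← hsd]
    linear_combination -phase x 2 * s * phase x 3 * (-((v 1 : ℂ) / 2) + Complex.I * s * c * v 2) * hinv
      - phase x 2 * phase x 3 * c * Complex.I * v 2 / 2 * h11
  · refine (((hp 2).mul (hs 1)).mul (hp' 3)).congr_deriv ?_
    simp only [Matrix.mul_apply, Fin.sum_univ_two, Matrix.of_apply, Matrix.cons_val, Fin.zero_eta,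
      Fin.mk_one, Pi.mul_apply, zero_smul, add_zero, ← hcd, ← hsd]
    linear_combination -phase x 2 * c * phaseInv x 3 * ((v 1 : ℂ) / 2 + Complex.I * s * c * v 2) * hinv
      - phase x 2 * phaseInv x 3 * s * Complex.I * v 2 / 2 * h11
  · refine (((hp' 2).mul (hs 1)).mul (hp 3)).neg.congr_deriv ?_
    simp only [Matrix.mul_apply, Fin.sum_univ_two, Matrix.of_apply, Matrix.cons_val, Fin.zero_eta,
      Fin.mk_one, Pi.mul_apply, zero_smul, add_zero, ← hcd, ← hsd]
    linear_combination -phaseInv x 2 * c * phase x 3 * (-((v 1 : ℂ) / 2) + Complex.I * s * c * v 2) * hinv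
      - phaseInv x 2 * phase x 3 * s * Complex.I * v 2 / 2 * h11
  · refine (((hp' 2).mul (hc 1)).mul (hp' 3)).congr_deriv ?_
    simp only [Matrix.mul_apply, Fin.sum_univ_two, Matrix.of_apply, Matrix.cons_val, Fin.zero_eta,
      Fin.mk_one, Pi.mul_apply, zero_smul, add_zero, ← hcd, ← hsd]
    linear_combination phaseInv x 2 * s * phaseInv x 3 * ((v 1 : ℂ) / 2 + Complex.I * s * c * v 2) * hinv
      + phaseInv x 2 * phaseInv x 3 * c * Complex.I * v 2 / 2 * h11

/-! ### Exterior calculus of the self-dual forms -/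

theorem wedge_toForm_apply (α β : Covector) (v : Fin 2 → Coord4) :
    wedge α (toForm β) v = α (v 0) * β (v 1) - α (v 1) * β (v 0) := by
  simp [wedge, toForm, ContinuousAlternatingMap.alternatizeUncurryFin_apply, Fin.removeNth]
  ring

theorem wedge_two_apply (α : Covector) (ω : Coord4 [⋀^Fin 2]→L[ℝ] ℝ) (v : Fin 3 → Coord4) :
    wedge α ω v = α (v 0) * ω ![v 1, v 2] - α (v 1) * ω ![v 0, v 2] + α (v 2) * ω ![v 0, v 1] := by
  have h0 : (0 : Fin 3).removeNth v = ![v 1, v 2] := by ext i; fin_cases i <;> rfl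
  have h1 : (1 : Fin 3).removeNth v = ![v 0, v 2] := by ext i; fin_cases i <;> rfl
  have h2 : (2 : Fin 3).removeNth v = ![v 0, v 1] := by ext i; fin_cases i <;> rfl
  simp [wedge, ContinuousAlternatingMap.alternatizeUncurryFin_apply, Fin.sum_univ_three, h0, h1, h2]
  ring

/-- The two nonzero terms of the `ε`-sum are equal and absorb the factor `1/2`. Addition in `Fin 3`
is cyclic, so `(i, i+1, i+2)` is always an even permutation. -/
theorem selfDualForm_apply_tetrad (i : Fin 3) (x : Coord4) (v : Fin 2 → Coord4) :
    selfDualForm i x v = wedge (tetrad 0 x) (toForm (tetrad i.succ x)) v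
      + wedge (tetrad (i + 1).succ x) (toForm (tetrad (i + 2).succ x)) v := by
  fin_cases i <;>
    simp [selfDualForm, Fin.sum_univ_three, levi, wedge_toForm_apply] <;> ring

/-- The coefficient of `dr ∧ ηᵢ` in `Σᵢ`. -/
noncomputable def radialCoeff (i : Fin 3) (r : ℝ) : ℝ := ![r + 1, r + 1, 1] i

/-- The coefficient of `ηᵢ₊₁ ∧ ηᵢ₊₂` in `Σᵢ`. -/
noncomputable def angularCoeff (i : Fin 3) (r : ℝ) : ℝ := ![r, r, r * (r + 1)] i

theorem selfDualForm_apply {x : Coord4} (hx : x ∈ chart) (i : Fin 3) (v : Fin 2 → Coord4) :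
    selfDualForm i x v
      = radialCoeff i (x 0) * (v 0 0 * eta i x (v 1) - v 1 0 * eta i x (v 0))
        + angularCoeff i (x 0) * (eta (i + 1) x (v 0) * eta (i + 2) x (v 1)
          - eta (i + 1) x (v 1) * eta (i + 2) x (v 0)) := by
  obtain ⟨hr, -, -⟩ := hx
  have hV : 0 < potV x := by unfold potV; positivity
  have hs : Real.sqrt (potV x) ^ 2 = potV x := Real.sq_sqrt hV.le
  have hs0 : Real.sqrt (potV x) ≠ 0 := (Real.sqrt_pos.2 hV).ne'
  have hrV : x 0 * Real.sqrt (potV x) ^ 2 = x 0 + 1 := by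
    rw [hs, potV]; field_simp
  rw [selfDualForm_apply_tetrad, wedge_toForm_apply, wedge_toForm_apply]
  fin_cases i
  · simp [tetrad, dx, radialCoeff, angularCoeff]
    generalize Real.sqrt (potV x) = s at hs0 hrV
    field_simp
    linear_combination (v 0 0 * eta 0 x (v 1) - v 1 0 * eta 0 x (v 0)) * hrV
  · simp [tetrad, dx, radialCoeff, angularCoeff]
    generalize Real.sqrt (potV x) = s at hs0 hrV
    field_simp
    linear_combination (v 0 0 * eta 1 x (v 1) - v 1 0 * eta 1 x (v 0)) * hrV
  · simp [tetrad, dx, radialCoeff, angularCoeff]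
    generalize Real.sqrt (potV x) = s at hs0 hrV
    field_simp
    linear_combination (eta 0 x (v 0) * eta 1 x (v 1) - eta 0 x (v 1) * eta 1 x (v 0))
      * x 0 * hrV

theorem isOpen_chart : IsOpen chart := by
  have h : chart = (fun x : Coord4 => x 0) ⁻¹' Set.Ioi 0 ∩
      (fun x : Coord4 => x 1) ⁻¹' Set.Ioo 0 Real.pi := by
    ext x; simp [chart]
  rw [h]
  exact (isOpen_Ioi.preimage (continuous_apply 0)).inter (isOpen_Ioo.preimage (continuous_apply 1))

theorem covector_apply (α : Covector) (w : Coord4) : α w = ∑ k, α (partialVec k) * w k := by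
  conv_lhs => rw [← Finset.univ_sum_single w]
  rw [map_sum]
  refine Finset.sum_congr rfl fun k _ => ?_
  rw [mul_comm, ← smul_eq_mul, ← map_smul, partialVec, ← Pi.single_smul, smul_eq_mul, mul_one]

theorem _root_.DifferentiableAt.wedge_toForm {α β : Coord4 → Covector} {x : Coord4}
    (hα : DifferentiableAt ℝ α x) (hβ : DifferentiableAt ℝ β x) :
    DifferentiableAt ℝ (fun y => wedge (α y) (toForm (β y))) x := by
  -- Expanding in the constant forms `dxₖ ∧ dxₗ` leaves only real-valued coefficients to
  -- differentiate.
  have h : (fun y => wedge (α y) (toForm (β y))) = fun y => ∑ k, ∑ l,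
      (α y (partialVec k) * β y (partialVec l)) • wedge (dx k) (toForm (dx l)) := by
    funext y
    ext v
    simp only [ContinuousAlternatingMap.sum_apply, ContinuousAlternatingMap.smul_apply,
      wedge_toForm_apply, smul_eq_mul]
    rw [covector_apply (α y) (v 0), covector_apply (α y) (v 1), covector_apply (β y) (v 0),
      covector_apply (β y) (v 1), Finset.sum_mul_sum, Finset.sum_mul_sum,
      ← Finset.sum_sub_distrib]
    refine Finset.sum_congr rfl fun k _ => ?_
    rw [← Finset.sum_sub_distrib]
    refine Finset.sum_congr rfl fun l _ => ?_
    simp only [dx, ContinuousLinearMap.proj_apply]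
    ring
  rw [h]
  fun_prop

theorem differentiable_eta (j : Fin 3) : Differentiable ℝ (eta j) := by
  fin_cases j <;> simp +unfoldPartialApp [eta] <;> fun_prop

theorem differentiableAt_tetrad {x : Coord4} (hx : x ∈ chart) (a : Fin 4) :
    DifferentiableAt ℝ (tetrad a) x := by
  obtain ⟨hr, -, -⟩ := hx
  have hV : potV x ≠ 0 := by unfold potV; positivity
  have hd : DifferentiableAt ℝ potV x := by
    unfold potV
    have h : DifferentiableAt ℝ (fun y : Coord4 => y 0) x := by fun_prop
    simpa only [one_div] using (h.fun_inv hr.ne').const_add 1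
  have hs : DifferentiableAt ℝ (fun y => Real.sqrt (potV y)) x := hd.sqrt hV
  have hs0 : Real.sqrt (potV x) ≠ 0 := by
    rw [Real.sqrt_ne_zero']; unfold potV; positivity
  have hη := fun j => (differentiable_eta j x)
  have hr' : DifferentiableAt ℝ (fun y : Coord4 => y 0) x := differentiableAt_apply 0 x
  fin_cases a
  · exact hs.fun_smul (differentiableAt_const _)
  · exact (hr'.fun_mul hs).fun_smul (hη 0)
  · exact (hr'.fun_mul hs).fun_smul (hη 1)
  · have h : DifferentiableAt ℝ (fun y => 1 / Real.sqrt (potV y)) x := by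
      simpa only [one_div] using hs.fun_inv hs0
    exact h.fun_smul (hη 2)

theorem differentiableAt_selfDualForm {x : Coord4} (hx : x ∈ chart) (i : Fin 3) :
    DifferentiableAt ℝ (selfDualForm i) x := by
  have h := differentiableAt_tetrad hx
  refine ((h 0).wedge_toForm (h i.succ)).fun_add (DifferentiableAt.fun_const_smul ?_ _)
  refine DifferentiableAt.fun_sum fun j _ => DifferentiableAt.fun_sum fun k _ => ?_
  exact DifferentiableAt.fun_const_smul ((h j.succ).wedge_toForm (h k.succ)) _

/-- The derivative of `ηⱼ(w)` in the direction `u`. -/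
noncomputable def etaDeriv (j : Fin 3) (x u w : Coord4) : ℝ :=
  ![-(Real.cos (x 3) * u 3) * w 1 + (Real.cos (x 1) * u 1 * Real.cos (x 3)
      - Real.sin (x 1) * (Real.sin (x 3) * u 3)) * w 2,
    -(Real.sin (x 3) * u 3) * w 1 + (Real.cos (x 1) * u 1 * Real.sin (x 3)
      + Real.sin (x 1) * (Real.cos (x 3) * u 3)) * w 2,
    -(Real.sin (x 1) * u 1) * w 2] j

theorem hasLineDerivAt_apply (k : Fin 4) (x u : Coord4) :
    HasLineDerivAt ℝ (fun y : Coord4 => y k) (u k) x u := by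
  simpa [HasLineDerivAt] using ((hasDerivAt_id (0 : ℝ)).mul_const (u k)).const_add (x k)

theorem hasLineDerivAt_eta (j : Fin 3) (x u w : Coord4) :
    HasLineDerivAt ℝ (fun y => eta j y w) (etaDeriv j x u w) x u := by
  have hs : ∀ k, HasDerivAt (fun t : ℝ => Real.sin ((x + t • u) k)) (Real.cos (x k) * u k) 0 :=
    fun k => by simpa using (HasDerivAt.sin (hasLineDerivAt_apply k x u))
  have hc : ∀ k, HasDerivAt (fun t : ℝ => Real.cos ((x + t • u) k)) (-Real.sin (x k) * u k) 0 :=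
    fun k => by simpa using (HasDerivAt.cos (hasLineDerivAt_apply k x u))
  unfold HasLineDerivAt
  fin_cases j
  · refine (((hs 3).neg.mul_const (w 1)).add (((hs 1).mul (hc 3)).mul_const (w 2))).congr_deriv ?_
    simp only [etaDeriv, Matrix.cons_val, Fin.zero_eta, zero_smul, add_zero]; ring
  · refine (((hc 3).mul_const (w 1)).add (((hs 1).mul (hs 3)).mul_const (w 2))).congr_deriv ?_
    simp [etaDeriv]
  · refine (((hasDerivAt_const 0 (w 3))).add ((hc 1).mul_const (w 2))).congr_deriv ?_
    simp [etaDeriv]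

/-- The Maurer-Cartan structure equations `dηᵢ = ηᵢ₊₁ ∧ ηᵢ₊₂`. -/
theorem etaDeriv_sub (j : Fin 3) (x u w : Coord4) :
    etaDeriv j x u w - etaDeriv j x w u
      = eta (j + 1) x u * eta (j + 2) x w - eta (j + 1) x w * eta (j + 2) x u := by
  have h := Real.sin_sq_add_cos_sq (x 3)
  fin_cases j
  · simp [etaDeriv, eta, dx]; ring
  · simp [etaDeriv, eta, dx]; ring
  · simp [etaDeriv, eta, dx]
    linear_combination Real.sin (x 1) * (u 1 * w 2 - w 1 * u 2) * h

theorem fderiv_selfDualForm_apply {x : Coord4} (hx : x ∈ chart) (i : Fin 3) (v : Fin 2 → Coord4)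
    (u : Coord4) :
    fderiv ℝ (fun y => selfDualForm i y v) x u
      = ![1, 1, 0] i * u 0 * (v 0 0 * eta i x (v 1) - v 1 0 * eta i x (v 0))
        + radialCoeff i (x 0) * (v 0 0 * etaDeriv i x u (v 1) - v 1 0 * etaDeriv i x u (v 0))
        + ![1, 1, 2 * x 0 + 1] i * u 0 * (eta (i + 1) x (v 0) * eta (i + 2) x (v 1)
          - eta (i + 1) x (v 1) * eta (i + 2) x (v 0))
        + angularCoeff i (x 0) * (etaDeriv (i + 1) x u (v 0) * eta (i + 2) x (v 1)
          + eta (i + 1) x (v 0) * etaDeriv (i + 2) x u (v 1)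
          - etaDeriv (i + 1) x u (v 1) * eta (i + 2) x (v 0)
          - eta (i + 1) x (v 1) * etaDeriv (i + 2) x u (v 0)) := by
  have hdiff : DifferentiableAt ℝ (fun y => selfDualForm i y v) x :=
    (ContinuousAlternatingMap.apply ℝ Coord4 ℝ v).differentiableAt.comp x
      (differentiableAt_selfDualForm hx i)
  rw [← hdiff.lineDeriv_eq_fderiv]
  refine HasLineDerivAt.lineDeriv ?_
  have hev : (fun y => selfDualForm i y v) =ᶠ[nhds x] fun y =>
      radialCoeff i (y 0) * (v 0 0 * eta i y (v 1) - v 1 0 * eta i y (v 0))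
        + angularCoeff i (y 0) * (eta (i + 1) y (v 0) * eta (i + 2) y (v 1)
          - eta (i + 1) y (v 1) * eta (i + 2) y (v 0)) :=
    Filter.eventuallyEq_of_mem (isOpen_chart.mem_nhds hx) fun y hy => selfDualForm_apply hy i v
  refine HasLineDerivAt.congr_of_eventuallyEq ?_ hev
  have hη := fun j w => hasLineDerivAt_eta j x u w
  have h0 := hasLineDerivAt_apply 0 x u
  have hA : HasLineDerivAt ℝ (fun y : Coord4 => radialCoeff i (y 0)) (![1, 1, 0] i * u 0) x u := by
    unfold HasLineDerivAt at *
    fin_cases i <;> simp [radialCoeff]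
    · simpa using h0
    · simpa using h0
    · exact hasDerivAt_const _ _
  have hB : HasLineDerivAt ℝ (fun y : Coord4 => angularCoeff i (y 0))
      (![1, 1, 2 * x 0 + 1] i * u 0) x u := by
    unfold HasLineDerivAt at *
    fin_cases i <;> simp [angularCoeff]
    · simpa using h0
    · simpa using h0
    · refine (h0.mul (h0.add_const 1)).congr_deriv ?_
      simp; ring
  unfold HasLineDerivAt at *
  refine ((hA.mul (((hη i (v 1)).const_mul (v 0 0)).sub ((hη i (v 0)).const_mul (v 1 0)))).add
    (hB.mul (((hη (i + 1) (v 0)).mul (hη (i + 2) (v 1))).sub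
      ((hη (i + 1) (v 1)).mul (hη (i + 2) (v 0)))))).congr_deriv ?_
  simp
  ring

/-- By the structure equations `d(ρᵢ dr ∧ ηᵢ) = -ρᵢ dr ∧ ηᵢ₊₁ ∧ ηᵢ₊₂`, while `ηᵢ₊₁ ∧ ηᵢ₊₂` is
closed. Only `αᵢ' - ρᵢ = (-r, -r, 2r)` survives. -/
theorem extDeriv_selfDualForm_apply {x : Coord4} (hx : x ∈ chart) (i : Fin 3)
    (v : Fin 3 → Coord4) :
    extDeriv (selfDualForm i) x v = ![-x 0, -x 0, 2 * x 0] i *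
      (v 0 0 * (eta (i + 1) x (v 1) * eta (i + 2) x (v 2) - eta (i + 1) x (v 2) * eta (i + 2) x (v 1))
      - v 1 0 * (eta (i + 1) x (v 0) * eta (i + 2) x (v 2)
        - eta (i + 1) x (v 2) * eta (i + 2) x (v 0))
      + v 2 0 * (eta (i + 1) x (v 0) * eta (i + 2) x (v 1)
        - eta (i + 1) x (v 1) * eta (i + 2) x (v 0))) := by
  have h0 : (0 : Fin 3).removeNth v = ![v 1, v 2] := by ext i; fin_cases i <;> rfl
  have h1 : (1 : Fin 3).removeNth v = ![v 0, v 2] := by ext i; fin_cases i <;> rfl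
  have h2 : (2 : Fin 3).removeNth v = ![v 0, v 1] := by ext i; fin_cases i <;> rfl
  rw [extDeriv_apply (differentiableAt_selfDualForm hx i), Fin.sum_univ_three, h0, h1, h2,
    fderiv_selfDualForm_apply hx, fderiv_selfDualForm_apply hx, fderiv_selfDualForm_apply hx]
  have d := fun j a b => etaDeriv_sub j x (v a) (v b)
  -- Splitting `αᵢ'` as `ρᵢ + (αᵢ' - ρᵢ)` isolates the part that cancels against `ρᵢ dr ∧ dηᵢ`.
  have hc : (![1, 1, 2 * x 0 + 1] : Fin 3 → ℝ) i
      = radialCoeff i (x 0) + (![-x 0, -x 0, 2 * x 0] : Fin 3 → ℝ) i := by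
    fin_cases i <;> simp [radialCoeff]; ring
  have dj := d (i + 1)
  have dk := d (i + 2)
  rw [show i + 1 + 1 = i + 2 by fin_cases i <;> rfl, show i + 1 + 2 = i by fin_cases i <;> rfl] at dj
  rw [show i + 2 + 1 = i by fin_cases i <;> rfl, show i + 2 + 2 = i + 1 by fin_cases i <;> rfl] at dk
  rw [hc]
  simp only [Fin.val_zero, Fin.val_one, Fin.val_two, pow_zero, pow_one, one_smul, neg_smul,
    even_two, Even.neg_pow, one_pow, Matrix.cons_val]
  linear_combination radialCoeff i (x 0) * (v 1 0 * d i 0 2 - v 2 0 * d i 0 1 - v 0 0 * d i 1 2)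
    + angularCoeff i (x 0) * (eta (i + 2) x (v 2) * dj 0 1 - eta (i + 2) x (v 1) * dj 0 2
      + eta (i + 2) x (v 0) * dj 1 2 + eta (i + 1) x (v 1) * dk 0 2
      - eta (i + 1) x (v 2) * dk 0 1 - eta (i + 1) x (v 0) * dk 1 2)

/-! ### Existence and uniqueness of the spin connection -/

/-- The self-dual spin connection `γᵢⱼ = ∑ₖ εᵢⱼₖ fₖ ηₖ`. -/
noncomputable def spinConnection (i j : Fin 3) (x : Coord4) : Covector :=
  ∑ k, (levi i j k * profile k (x 0)) • eta k x

theorem isSelfDualSpinConnection_spinConnection : IsSelfDualSpinConnection spinConnection where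
  antisymm x _ i j := by
    rw [spinConnection, spinConnection, ← Finset.sum_neg_distrib]
    refine Finset.sum_congr rfl fun k _ => ?_
    ext w
    simp only [smul_apply, neg_apply, smul_eq_mul, levi]
    ring
  cartan x hx i := by
    have hr : x 0 + 1 ≠ 0 := by have := hx.1; positivity
    ext v
    simp only [ContinuousAlternatingMap.add_apply, ContinuousAlternatingMap.sum_apply,
      extDeriv_selfDualForm_apply hx, wedge_two_apply, selfDualForm_apply hx,
      ContinuousAlternatingMap.coe_zero, Pi.zero_apply]
    fin_cases i <;>
      simp [Fin.sum_univ_three, spinConnection, levi, radialCoeff, angularCoeff, profile] <;>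
      field_simp <;> ring

/-- An antisymmetric matrix of covectors which annihilates the self-dual two-forms of a coframe
vanishes. -/
theorem eq_zero_of_wedge_selfDual {e : Fin 4 → Covector} {E : Fin 4 → Coord4}
    (hE : ∀ a b, e a (E b) = if a = b then 1 else 0) (hspan : ∀ w, w = ∑ a, e a w • E a)
    {S : Fin 3 → Coord4 [⋀^Fin 2]→L[ℝ] ℝ}
    (hS : ∀ i, S i = wedge (e 0) (toForm (e i.succ))
      + wedge (e (i + 1).succ) (toForm (e (i + 2).succ)))
    {δ : Fin 3 → Fin 3 → Covector} (hanti : ∀ i j, δ i j = -δ j i)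
    (hδ : ∀ i, ∑ j, wedge (δ i j) (S j) = 0) (i j : Fin 3) : δ i j = 0 := by
  have hdiag : ∀ i, δ i i = 0 := fun i => by
    ext w
    have h := congrArg (fun α : Covector => α w) (hanti i i)
    simp only [neg_apply] at h
    rw [zero_apply]
    linarith
  have hev : ∀ i a b c, ∑ j, (δ i j (E a) * S j ![E b, E c] - δ i j (E b) * S j ![E a, E c]
      + δ i j (E c) * S j ![E a, E b]) = 0 := by
    intro i a b c
    have h := congrArg (fun ω => ω ![E a, E b, E c]) (hδ i)
    simpa [wedge_two_apply, ContinuousAlternatingMap.sum_apply] using h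
  have h10 := hanti 1 0
  have h20 := hanti 2 0
  have h21 := hanti 2 1
  -- Three 3-forms with four components each give twelve linear equations for the twelve components
  -- of `δ₀₁`, `δ₀₂`, `δ₁₂`; the system is nonsingular.
  have key := fun i => And.intro (hev i 0 1 2) (And.intro (hev i 0 1 3)
    (And.intro (hev i 0 2 3) (hev i 1 2 3)))
  have k0 := key 0
  have k1 := key 1
  have k2 := key 2
  simp [Fin.sum_univ_three, hS, wedge_toForm_apply, hE, hdiag, h10, h20, h21] at k0 k1 k2
  have hz : ∀ a, δ 0 1 (E a) = 0 ∧ δ 0 2 (E a) = 0 ∧ δ 1 2 (E a) = 0 := by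
    intro a
    fin_cases a <;> refine ⟨?_, ?_, ?_⟩ <;> simp <;> linarith
  have hz' : ∀ i j, (∀ a, δ i j (E a) = 0) → δ i j = 0 := fun i j h => by
    ext w
    rw [hspan w, map_sum]
    simp [h]
  have h01 := hz' 0 1 fun a => (hz a).1
  have h02 := hz' 0 2 fun a => (hz a).2.1
  have h12 := hz' 1 2 fun a => (hz a).2.2
  fin_cases i <;> fin_cases j <;> simp [hdiag, h10, h20, h21, h01, h02, h12]

theorem IsSelfDualSpinConnection.unique {γ γ' : Fin 3 → Fin 3 → Coord4 → Covector}
    (h : IsSelfDualSpinConnection γ) (h' : IsSelfDualSpinConnection γ') {x : Coord4}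
    (hx : x ∈ chart) (i j : Fin 3) : γ i j x = γ' i j x := by
  have hr := hx.1
  have hV : 0 < potV x := by unfold potV; positivity
  have hs0 : Real.sqrt (potV x) ≠ 0 := (Real.sqrt_pos.2 hV).ne'
  have hsin : Real.sin (x 1) ≠ 0 := (Real.sin_pos_of_pos_of_lt_pi hx.2.1 hx.2.2).ne'
  have h1 := Real.sin_sq_add_cos_sq (x 3)
  set s := Real.sqrt (potV x) with hs
  -- The frame dual to the tetrad; it exists because `sin θ ≠ 0` on the chart.
  let E : Fin 4 → Coord4 :=
    ![![1 / s, 0, 0, 0],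
      (1 / (x 0 * s)) • ![0, -Real.sin (x 3), Real.cos (x 3) / Real.sin (x 1),
        -(Real.cos (x 3) * Real.cos (x 1) / Real.sin (x 1))],
      (1 / (x 0 * s)) • ![0, Real.cos (x 3), Real.sin (x 3) / Real.sin (x 1),
        -(Real.sin (x 3) * Real.cos (x 1) / Real.sin (x 1))],
      ![0, 0, 0, s]]
  have hE : ∀ a b, tetrad a x (E b) = if a = b then 1 else 0 := by
    intro a b
    fin_cases a <;> fin_cases b <;> simp [tetrad, E, eta, dx, ← hs] <;> field_simp <;>
      first | linear_combination h1 | ring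
  have hspan : ∀ w, w = ∑ a, tetrad a x w • E a := by
    intro w
    ext k
    fin_cases k <;> simp [Fin.sum_univ_four, tetrad, E, eta, dx, ← hs] <;> field_simp
    · linear_combination (-w 1) * h1
    · linear_combination (-w 2 * Real.sin (x 1)) * h1
    · linear_combination w 2 * Real.sin (x 1) * Real.cos (x 1) * h1
  have hd := eq_zero_of_wedge_selfDual (δ := fun i j => γ i j x - γ' i j x)
    (S := fun i => selfDualForm i x) hE hspan ?_ ?_ ?_ i j
  · exact sub_eq_zero.1 hd
  · intro i
    ext v
    exact selfDualForm_apply_tetrad i x v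
  · intro i j
    rw [h.antisymm x hx i j, h'.antisymm x hx i j]
    abel
  · intro i
    have e := h.cartan x hx i
    rw [← h'.cartan x hx i, add_right_inj] at e
    ext v
    have e' := congrArg (fun ω => ω v) e
    simp only [ContinuousAlternatingMap.add_apply, wedge_two_apply, sub_apply, Fin.sum_univ_three,
      ContinuousAlternatingMap.coe_zero, Pi.zero_apply] at e' ⊢
    linarith

theorem potentialComponent_spinConnection (i : Fin 3) (x : Coord4) :
    potentialComponent spinConnection i x = profile i (x 0) • eta i x := by
  ext v
  fin_cases i <;>
    simp [potentialComponent, spinConnection, Fin.sum_univ_three, levi] <;> ring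

theorem IsSelfDualSpinConnection.potentialComponent_eq {γ : Fin 3 → Fin 3 → Coord4 → Covector}
    (h : IsSelfDualSpinConnection γ) {x : Coord4} (hx : x ∈ chart) (i : Fin 3) :
    potentialComponent γ i x = profile i (x 0) • eta i x := by
  rw [← potentialComponent_spinConnection]
  simp only [potentialComponent, h.unique isSelfDualSpinConnection_spinConnection hx]

theorem eta_partialVec (j : Fin 3) (x : Coord4) :
    eta j x (partialVec 2) = unitVec j (x 1) (x 3) := by
  fin_cases j <;> simp [eta, dx, partialVec, unitVec]

theorem IsSelfDualSpinConnection.potentialComponent_partialVec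
    {γ : Fin 3 → Fin 3 → Coord4 → Covector} (h : IsSelfDualSpinConnection γ) {x : Coord4}
    (hx : x ∈ chart) (i : Fin 3) :
    potentialComponent γ i x (partialVec 2) = profile i (x 0) * unitVec i (x 1) (x 3) := by
  rw [h.potentialComponent_eq hx, ← eta_partialVec]
  rfl

/-! ### Parallel transport along the orbits -/

theorem hasDerivAt_exp_smul_apply (X : Matrix (Fin 2) (Fin 2) ℂ) (t : ℝ) (a b : Fin 2) :
    HasDerivAt (fun u : ℝ => NormedSpace.exp ((u : ℂ) • X) a b)
      ((NormedSpace.exp ((t : ℂ) • X) * X) a b) t := by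
  let _ : NormedRing (Matrix (Fin 2) (Fin 2) ℂ) := Matrix.linftyOpNormedRing
  let _ : NormedAlgebra ℂ (Matrix (Fin 2) (Fin 2) ℂ) := Matrix.linftyOpNormedAlgebra
  have h : HasDerivAt (fun u : ℂ => NormedSpace.exp (u • X)) (NormedSpace.exp ((t : ℂ) • X) * X) t :=
    hasDerivAt_exp_smul_const X (t : ℂ)
  have hL := (LinearMap.toContinuousLinearMap
    (Matrix.entryLinearMap ℂ ℂ a b)).hasFDerivAt.comp_hasDerivAt (t : ℂ) h
  exact hL.comp_ofReal

theorem exp_smul_mul_comm (X : Matrix (Fin 2) (Fin 2) ℂ) (t : ℂ) :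
    NormedSpace.exp (t • X) * X = X * NormedSpace.exp (t • X) := by
  let _ : NormedRing (Matrix (Fin 2) (Fin 2) ℂ) := Matrix.linftyOpNormedRing
  let _ : NormedAlgebra ℂ (Matrix (Fin 2) (Fin 2) ℂ) := Matrix.linftyOpNormedAlgebra
  exact (((Commute.refl X).smul_left t).exp_left).eq

/-- The transport of a potential which is constant along an orbit. -/
theorem isHolonomy_of_const {A : Coord4 → Coord4 → Matrix (Fin 2) (Fin 2) ℂ} {q : Coord3}
    {M : Matrix (Fin 2) (Fin 2) ℂ} (hM : ∀ s, A (orbitPoint q s) (partialVec 2) = M) :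
    IsHolonomy A q (NormedSpace.exp (((2 * Real.pi : ℝ) : ℂ) • -M)) := by
  refine ⟨⟨fun s => NormedSpace.exp ((s : ℂ) • -M), ?_, ?_⟩, ?_⟩
  · simp
  · intro s _ a b
    rw [hM, ← exp_smul_mul_comm]
    exact (hasDerivAt_exp_smul_apply (-M) s a b).hasDerivWithinAt
  · intro Ψ hΨ
    -- Uniqueness by an integrating factor: `exp(sM) Ψ(s)` has derivative `exp(sM)(M - M)Ψ(s) = 0`.
    have hconst : ∀ a b, ∀ s ∈ Set.Icc 0 (2 * Real.pi),
        (NormedSpace.exp ((s : ℂ) • M) * Ψ s) a b = (1 : Matrix (Fin 2) (Fin 2) ℂ) a b := by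
      intro a b
      have hd : ∀ s ∈ Set.Icc 0 (2 * Real.pi), HasDerivWithinAt
          (fun t : ℝ => (NormedSpace.exp ((t : ℂ) • M) * Ψ t) a b) 0
          (Set.Icc 0 (2 * Real.pi)) s := by
        intro s hs
        have h := HasDerivWithinAt.fun_sum (u := Finset.univ) fun c _ =>
          ((hasDerivAt_exp_smul_apply M s a c).hasDerivWithinAt (s := Set.Icc 0 (2 * Real.pi))).mul
            (hΨ.ode s hs c b)
        refine (h.congr_deriv ?_)
        rw [Finset.sum_add_distrib, hM]
        rw [← Matrix.mul_apply, ← Matrix.mul_apply, ← Matrix.add_apply, neg_mul, mul_neg,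
          ← Matrix.mul_assoc, add_neg_cancel, Matrix.zero_apply]
      intro s hs
      have h := constant_of_has_deriv_right_zero (fun s hs => (hd s hs).continuousWithinAt)
        (fun s hs => (hd s (Set.Ico_subset_Icc_self hs)).mono_of_mem_nhdsWithin
          (Icc_mem_nhdsGE_of_mem hs)) s hs
      rw [h]
      simp [hΨ.init]
    have h2 : NormedSpace.exp (((2 * Real.pi : ℝ) : ℂ) • M) * Ψ (2 * Real.pi) = 1 :=
      Matrix.ext fun a b => hconst a b _ (Set.right_mem_Icc.2 (by positivity))
    rw [smul_neg, Matrix.exp_neg]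
    exact (Matrix.inv_eq_right_inv h2).symm

/-- `A_φ` involves only `r`, `θ`, `ψ`, hence is constant along an orbit; `2π · (i/2) = iπ` gives the
exponent of the Skyrme field. -/
theorem IsSelfDualSpinConnection.isHolonomy {γ : Fin 3 → Fin 3 → Coord4 → Covector}
    (h : IsSelfDualSpinConnection γ) {q : Coord3} (hq : q ∈ orbitSpace) :
    IsHolonomy (potential γ) q (skyrmeField q) := by
  have hc : ∀ s, orbitPoint q s ∈ chart := fun s => ⟨hq.1, hq.2.1⟩
  have hM : ∀ s, potential γ (orbitPoint q s) (partialVec 2)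
      = ∑ j, ((profile j (q 0) * unitVec j (q 1) (q 2) : ℝ) : ℂ) • gen j := by
    intro s
    simp only [potential, h.potentialComponent_partialVec (hc s)]
    rfl
  convert isHolonomy_of_const hM using 1
  rw [skyrmeField, ← Finset.sum_neg_distrib, Finset.smul_sum, Finset.smul_sum]
  congr 1
  refine Finset.sum_congr rfl fun j _ => ?_
  rw [gen, smul_smul, smul_smul, smul_neg, smul_smul, ← neg_smul]
  congr 1
  push_cast
  ring

/-! ### Unit quaternions and the trace form -/

/-- The matrix `a + i (b τ₁ + c τ₂ + d τ₃)`. -/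
noncomputable def quatMatrix (a b c d : ℝ) : Matrix (Fin 2) (Fin 2) ℂ :=
  !![(a : ℂ) + Complex.I * d, Complex.I * b + c; Complex.I * b - c, (a : ℂ) - Complex.I * d]

theorem quatMatrix_mem_specialUnitaryGroup {a b c d : ℝ}
    (h : a ^ 2 + b ^ 2 + c ^ 2 + d ^ 2 = 1) :
    quatMatrix a b c d ∈ Matrix.specialUnitaryGroup (Fin 2) ℂ := by
  have h' : (a : ℂ) ^ 2 + (b : ℂ) ^ 2 + (c : ℂ) ^ 2 + (d : ℂ) ^ 2 = 1 := by exact_mod_cast h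
  rw [Matrix.mem_specialUnitaryGroup_iff, Matrix.mem_unitaryGroup_iff]
  constructor
  · ext i j
    fin_cases i <;> fin_cases j <;>
      simp [quatMatrix, Matrix.mul_apply, Fin.sum_univ_two, Matrix.star_apply] <;> ring_nf <;>
      simp only [Complex.I_sq] <;> linear_combination h'
  · rw [Matrix.det_fin_two]
    simp [quatMatrix]
    linear_combination h' - ((b : ℂ) ^ 2 + (d : ℂ) ^ 2) * Complex.I_sq

/-- The exponential of a combination of Pauli matrices. -/
theorem exp_pauli (F : Fin 3 → ℝ) {ρ : ℝ} (hρ : ρ ^ 2 = F 0 ^ 2 + F 1 ^ 2 + F 2 ^ 2) :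
    NormedSpace.exp ((-(Complex.I * (Real.pi : ℂ))) • ∑ j, ((F j : ℝ) : ℂ) • pauli j)
      = quatMatrix (Real.cos (Real.pi * ρ)) (-(Real.sin (Real.pi * ρ) / ρ * F 0))
        (-(Real.sin (Real.pi * ρ) / ρ * F 1)) (-(Real.sin (Real.pi * ρ) / ρ * F 2)) := by
  rcases eq_or_ne ρ 0 with h0 | h0
  · have hF : ∀ j, F j = 0 := by
      have h : F 0 ^ 2 + F 1 ^ 2 + F 2 ^ 2 = 0 := by rw [← hρ, h0]; ring
      intro j
      fin_cases j <;> simp <;> nlinarith [sq_nonneg (F 0), sq_nonneg (F 1), sq_nonneg (F 2)]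
    ext i j
    -- Here `sin(πρ)/ρ` has the default value `0`, which is harmless since `F = 0`.
    fin_cases i <;> fin_cases j <;> simp [quatMatrix, hF, h0]
  · have h0' : (ρ : ℂ) ≠ 0 := by exact_mod_cast h0
    have hρ' : (ρ : ℂ) ^ 2 = (F 0 : ℂ) ^ 2 + (F 1 : ℂ) ^ 2 + (F 2 : ℂ) ^ 2 := by exact_mod_cast hρ
    -- `(∑ Fⱼ τⱼ)² = ρ²`, so the normalised matrix squares to `-1` and Euler's formula applies. The
    -- sign of `ρ` is immaterial.
    have hJ : ((-(Complex.I / ρ)) • ∑ j, ((F j : ℝ) : ℂ) • pauli j)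
        * ((-(Complex.I / ρ)) • ∑ j, ((F j : ℝ) : ℂ) • pauli j) = -1 := by
      have hsq : (∑ j, ((F j : ℝ) : ℂ) • pauli j) * (∑ j, ((F j : ℝ) : ℂ) • pauli j)
          = ((ρ : ℂ) ^ 2) • (1 : Matrix (Fin 2) (Fin 2) ℂ) := by
        ext i j
        rw [hρ']
        fin_cases i <;> fin_cases j <;>
          simp [pauli, Matrix.mul_apply, Fin.sum_univ_two, Fin.sum_univ_three] <;> ring_nf <;>
          simp only [Complex.I_sq] <;> ring
      rw [smul_mul_smul_comm, hsq, smul_smul, ← neg_one_smul ℂ (1 : Matrix (Fin 2) (Fin 2) ℂ)]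
      congr 1
      field_simp
      exact Complex.I_sq
    have h := exp_smul_of_mul_self_eq_neg_one hJ (Real.pi * ρ)
    rw [smul_smul] at h
    rw [show (-(Complex.I * (Real.pi : ℂ))) = ((Real.pi * ρ : ℝ) : ℂ) * -(Complex.I / ρ) by
      push_cast; field_simp, h]
    ext i j
    fin_cases i <;> fin_cases j <;>
      simp [pauli, quatMatrix, Fin.sum_univ_three] <;> field_simp <;> ring_nf <;> simp <;> ring

theorem skyrmeField_mem_specialUnitaryGroup (q : Coord3) :
    skyrmeField q ∈ Matrix.specialUnitaryGroup (Fin 2) ℂ := by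
  set F : Fin 3 → ℝ := fun j => profile j (q 0) * unitVec j (q 1) (q 2) with hF
  have h0 : 0 ≤ F 0 ^ 2 + F 1 ^ 2 + F 2 ^ 2 := by positivity
  have hρ := Real.sq_sqrt h0
  have h := exp_pauli F hρ
  set ρ := Real.sqrt (F 0 ^ 2 + F 1 ^ 2 + F 2 ^ 2)
  rw [skyrmeField, h]
  refine quatMatrix_mem_specialUnitaryGroup ?_
  have h1 := Real.sin_sq_add_cos_sq (Real.pi * ρ)
  rcases eq_or_ne ρ 0 with hz | hz
  · simp [hz]
  · have : (Real.sin (Real.pi * ρ) / ρ) ^ 2 * ρ ^ 2 = Real.sin (Real.pi * ρ) ^ 2 := by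
      field_simp
    linear_combination h1 + this - (Real.sin (Real.pi * ρ) / ρ) ^ 2 * hρ

theorem sum_perm_fin_three (f : Equiv.Perm (Fin 3) → ℂ) :
    ∑ σ : Equiv.Perm (Fin 3), f σ = f 1 + f (Equiv.swap 0 1) + f (Equiv.swap 0 2)
      + f (Equiv.swap 1 2) + f (finRotate 3) + f (finRotate 3 * finRotate 3) := by
  have h : (Finset.univ : Finset (Equiv.Perm (Fin 3))) = {1, Equiv.swap 0 1, Equiv.swap 0 2,
      Equiv.swap 1 2, finRotate 3, finRotate 3 * finRotate 3} := by decide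
  rw [h, Finset.sum_insert (by decide), Finset.sum_insert (by decide),
    Finset.sum_insert (by decide), Finset.sum_insert (by decide), Finset.sum_insert (by decide),
    Finset.sum_singleton]
  ring

/-- The alternating sum of the traces of triple products of elements of `su(2)`. -/
theorem sum_sign_trace_quatMatrix (l : Matrix (Fin 3) (Fin 3) ℝ) :
    ∑ σ : Equiv.Perm (Fin 3), ((Equiv.Perm.sign σ : ℤ) : ℂ) *
      Matrix.trace (quatMatrix 0 (l (σ 0) 0) (l (σ 0) 1) (l (σ 0) 2)
        * quatMatrix 0 (l (σ 1) 0) (l (σ 1) 1) (l (σ 1) 2)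
        * quatMatrix 0 (l (σ 2) 0) (l (σ 2) 1) (l (σ 2) 2)) = ((12 * l.det : ℝ) : ℂ) := by
  -- The trace of a product of three imaginary quaternions is twice their triple product; the six
  -- signed permutations then give `12 det`.
  have ht : ∀ b c d b' c' d' b'' c'' d'' : ℝ,
      Matrix.trace (quatMatrix 0 b c d * quatMatrix 0 b' c' d' * quatMatrix 0 b'' c'' d'')
        = ((2 * (b * (c' * d'' - d' * c'') - c * (b' * d'' - d' * b'')
          + d * (b' * c'' - c' * b'')) : ℝ) : ℂ) := by
    intro b c d b' c' d' b'' c'' d''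
    simp [quatMatrix, Matrix.trace_fin_two]
    ring_nf
    simp only [Complex.I_sq]
    ring
  have s1 : Equiv.Perm.sign (finRotate 3) = 1 := by decide
  have s2 : Equiv.Perm.sign (finRotate 3 * finRotate 3) = 1 := by decide
  have s3 : Equiv.Perm.sign (Equiv.swap (0 : Fin 3) 1) = -1 := by decide
  have s4 : Equiv.Perm.sign (Equiv.swap (0 : Fin 3) 2) = -1 := by decide
  have s5 : Equiv.Perm.sign (Equiv.swap (1 : Fin 3) 2) = -1 := by decide
  have e1 : ∀ i : Fin 3, finRotate 3 i = i + 1 := by decide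
  have e3 : Equiv.swap (0 : Fin 3) 1 2 = 2 := by decide
  have e4 : Equiv.swap (0 : Fin 3) 2 1 = 1 := by decide
  have e5 : Equiv.swap (1 : Fin 3) 2 0 = 0 := by decide
  simp only [ht]
  rw [sum_perm_fin_three, s1, s2, s3, s4, s5, Matrix.det_fin_three]
  simp only [Equiv.Perm.sign_one, Equiv.Perm.mul_apply, Equiv.Perm.one_apply, e1, e3, e4, e5,
    Equiv.swap_apply_left, Equiv.swap_apply_right, Fin.isValue, Fin.reduceAdd, zero_add]
  push_cast
  ring

/-- A tangent vector to `S³` is orthogonal to its base point, which is why its left translate to the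
identity has no real part. -/
theorem quatMatrix_mul_quatMatrix {a b c d a' b' c' d' : ℝ}
    (h : a ^ 2 + b ^ 2 + c ^ 2 + d ^ 2 = 1) (h' : a * a' + b * b' + c * c' + d * d' = 0) :
    (quatMatrix a b c d)⁻¹ * quatMatrix a' b' c' d'
      = quatMatrix 0 (a * b' - b * a' + c * d' - d * c') (a * c' - c * a' + d * b' - b * d')
        (a * d' - d * a' + b * c' - c * b') := by
  have hC : (a : ℂ) ^ 2 + (b : ℂ) ^ 2 + (c : ℂ) ^ 2 + (d : ℂ) ^ 2 = 1 := by exact_mod_cast h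
  have hC' : (a : ℂ) * a' + b * b' + c * c' + d * d' = 0 := by exact_mod_cast h'
  have hinv : (quatMatrix a b c d)⁻¹ = quatMatrix a (-b) (-c) (-d) := by
    refine Matrix.inv_eq_right_inv ?_
    ext i j
    fin_cases i <;> fin_cases j <;>
      simp [quatMatrix, Matrix.mul_apply, Fin.sum_univ_two] <;> ring_nf <;>
      simp only [Complex.I_sq] <;> linear_combination hC
  rw [hinv]
  ext i j
  fin_cases i <;> fin_cases j <;>
    simp [quatMatrix, Matrix.mul_apply, Fin.sum_univ_two] <;> ring_nf <;>
    simp only [Complex.I_sq] <;> first | linear_combination hC' | ring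

theorem traceCube_eq_of_eventuallyEq {U : Coord3 → Matrix (Fin 2) (Fin 2) ℂ} {q : Coord3}
    {a b c d : Coord3 → ℝ} {a' b' c' d' : Fin 3 → ℝ}
    (hU : U =ᶠ[nhds q] fun p => quatMatrix (a p) (b p) (c p) (d p))
    (h : a q ^ 2 + b q ^ 2 + c q ^ 2 + d q ^ 2 = 1)
    (h' : ∀ k, a q * a' k + b q * b' k + c q * c' k + d q * d' k = 0)
    (ha : ∀ k, HasLineDerivAt ℝ a (a' k) q (partialVec k))
    (hb : ∀ k, HasLineDerivAt ℝ b (b' k) q (partialVec k))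
    (hc : ∀ k, HasLineDerivAt ℝ c (c' k) q (partialVec k))
    (hd : ∀ k, HasLineDerivAt ℝ d (d' k) q (partialVec k)) :
    traceCube U q = ((12 * (Matrix.of fun k => ![a q * b' k - b q * a' k + c q * d' k - d q * c' k,
      a q * c' k - c q * a' k + d q * b' k - b q * d' k,
      a q * d' k - d q * a' k + b q * c' k - c q * b' k]).det : ℝ) : ℂ) := by
  have hL : ∀ k, leftCurrent U k q = quatMatrix 0 (a q * b' k - b q * a' k + c q * d' k - d q * c' k)
      (a q * c' k - c q * a' k + d q * b' k - b q * d' k)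
      (a q * d' k - d q * a' k + b q * c' k - c q * b' k) := by
    intro k
    rw [← quatMatrix_mul_quatMatrix h (h' k), leftCurrent, hU.self_of_nhds]
    congr 1
    ext i j
    rw [Matrix.of_apply]
    refine HasLineDerivAt.lineDeriv ?_
    refine HasLineDerivAt.congr_of_eventuallyEq ?_ (hU.fun_comp fun M => M i j)
    have ha := (ha k).ofReal_comp
    have hb := (hb k).ofReal_comp
    have hc := (hc k).ofReal_comp
    have hd := (hd k).ofReal_comp
    unfold HasLineDerivAt
    fin_cases i <;> fin_cases j
    · exact ha.add (hd.const_mul Complex.I)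
    · exact (hb.const_mul Complex.I).add hc
    · exact (hb.const_mul Complex.I).sub hc
    · exact ha.sub (hd.const_mul Complex.I)
  rw [← sum_sign_trace_quatMatrix]
  simp only [traceCube, hL]
  rfl

/-! ### The Skyrme field in the compact radius; smoothness and degree density -/

/-- `|F| / s` for the vector `F = (fⱼ nⱼ)`, in terms of `s = r / (r + 1)` and `θ`. -/
noncomputable def kappa (s θ : ℝ) : ℝ :=
  Real.sqrt (Real.sin θ ^ 2 + (2 - s) ^ 2 * Real.cos θ ^ 2)

/-- The bound `s < 2` leaves room beyond the face `s = 1`, so the fluxes used later are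
differentiable on the whole closed box. -/
theorem kappa_arg_pos {s : ℝ} (hs : s < 2) (θ : ℝ) :
    0 < Real.sin θ ^ 2 + (2 - s) ^ 2 * Real.cos θ ^ 2 := by
  have h := Real.sin_sq_add_cos_sq θ
  have hm : 0 < (2 - s) ^ 2 := by have : 0 < 2 - s := by linarith
                                  positivity
  rcases eq_or_ne (Real.cos θ) 0 with hc | hc
  · rw [hc] at h ⊢; nlinarith
  · positivity

theorem kappa_pos {s : ℝ} (hs : s < 2) (θ : ℝ) : 0 < kappa s θ :=
  Real.sqrt_pos.2 (kappa_arg_pos hs θ)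

theorem kappa_sq {s : ℝ} (hs : s < 2) (θ : ℝ) :
    kappa s θ ^ 2 = Real.sin θ ^ 2 + (2 - s) ^ 2 * Real.cos θ ^ 2 :=
  Real.sq_sqrt (kappa_arg_pos hs θ).le

section Curves

variable {S Θ : ℝ → ℝ} {σ τ t : ℝ}

theorem _root_.HasDerivAt.kappa (hS : HasDerivAt S σ t) (hΘ : HasDerivAt Θ τ t) (hs : S t < 2) :
    HasDerivAt (fun u => kappa (S u) (Θ u))
      (((1 - (2 - S t) ^ 2) * Real.sin (Θ t) * Real.cos (Θ t) * τ
        - (2 - S t) * Real.cos (Θ t) ^ 2 * σ) / kappa (S t) (Θ t)) t := by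
  have h := ((hΘ.sin.fun_pow 2).fun_add
    (((hS.const_sub 2).fun_pow 2).fun_mul (hΘ.cos.fun_pow 2))).sqrt (kappa_arg_pos hs _).ne'
  refine h.congr_deriv ?_
  have hk := (kappa_pos hs (Θ t)).ne'
  rw [← TaubNUT.kappa]
  field_simp
  push_cast
  ring

/-- With the next lemma: `(sin θ, -(2-s) cos θ)/κ` is a unit vector, so it moves by rotation, at the
rate `ω = ((2-s) θ' + sin θ cos θ s')/κ²`. -/
theorem hasDerivAt_sin_div_kappa (hS : HasDerivAt S σ t) (hΘ : HasDerivAt Θ τ t) (hs : S t < 2) :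
    HasDerivAt (fun u => Real.sin (Θ u) / kappa (S u) (Θ u))
      (((2 - S t) * Real.cos (Θ t) / kappa (S t) (Θ t))
        * (((2 - S t) * τ + Real.sin (Θ t) * Real.cos (Θ t) * σ) / kappa (S t) (Θ t) ^ 2)) t := by
  have hk := (kappa_pos hs (Θ t)).ne'
  have hk2 := kappa_sq hs (Θ t)
  have h1 := Real.sin_sq_add_cos_sq (Θ t)
  refine (hΘ.sin.fun_div (hS.kappa hΘ hs) hk).congr_deriv ?_
  field_simp
  rw [hk2]
  linear_combination ((2 - S t) ^ 2 * τ * Real.cos (Θ t)) * h1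

theorem hasDerivAt_cos_div_kappa (hS : HasDerivAt S σ t) (hΘ : HasDerivAt Θ τ t) (hs : S t < 2) :
    HasDerivAt (fun u => -((2 - S u) * Real.cos (Θ u)) / kappa (S u) (Θ u))
      ((Real.sin (Θ t) / kappa (S t) (Θ t))
        * (((2 - S t) * τ + Real.sin (Θ t) * Real.cos (Θ t) * σ) / kappa (S t) (Θ t) ^ 2)) t := by
  have hk := (kappa_pos hs (Θ t)).ne'
  have hk2 := kappa_sq hs (Θ t)
  have h1 := Real.sin_sq_add_cos_sq (Θ t)
  refine ((((hS.const_sub 2).fun_mul hΘ.cos).fun_neg).fun_div (hS.kappa hΘ hs) hk).congr_deriv ?_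
  field_simp
  rw [hk2]
  linear_combination ((2 - S t) * τ * Real.sin (Θ t)) * h1

end Curves

/-- The coordinate `s = r / (r + 1)`. -/
noncomputable def compactRadius (q : Coord3) : ℝ := q 0 / (q 0 + 1)

theorem compactRadius_mem {q : Coord3} (hq : q ∈ orbitSpace) :
    0 < compactRadius q ∧ compactRadius q < 1 := by
  have hr := hq.1
  unfold compactRadius
  exact ⟨by positivity, by rw [div_lt_one (by positivity)]; linarith⟩

theorem skyrmeField_eq {q : Coord3} (hq : q ∈ orbitSpace) :
    skyrmeField q = quatMatrix (Real.cos (Real.pi * (compactRadius q * kappa (compactRadius q) (q 1))))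
      (Real.sin (Real.pi * (compactRadius q * kappa (compactRadius q) (q 1)))
        * (Real.sin (q 1) / kappa (compactRadius q) (q 1)) * Real.cos (q 2))
      (Real.sin (Real.pi * (compactRadius q * kappa (compactRadius q) (q 1)))
        * (Real.sin (q 1) / kappa (compactRadius q) (q 1)) * Real.sin (q 2))
      (Real.sin (Real.pi * (compactRadius q * kappa (compactRadius q) (q 1)))
        * (-((2 - compactRadius q) * Real.cos (q 1)) / kappa (compactRadius q) (q 1))) := by
  obtain ⟨hs0, hs1⟩ := compactRadius_mem hq
  have hr : q 0 + 1 ≠ 0 := by have := hq.1; positivity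
  have hp0 : profile 0 (q 0) = -compactRadius q := by simp [profile, compactRadius, neg_div]
  have hp1 : profile 1 (q 0) = -compactRadius q := by simp [profile, compactRadius, neg_div]
  have hp2 : profile 2 (q 0) = compactRadius q * (2 - compactRadius q) := by
    simp [profile, compactRadius]; field_simp; ring
  have hk := kappa_pos (s := compactRadius q) (by linarith) (q 1)
  have hk2 := kappa_sq (s := compactRadius q) (by linarith) (q 1)
  have h1 := Real.sin_sq_add_cos_sq (q 2)
  rw [skyrmeField, exp_pauli (fun j => profile j (q 0) * unitVec j (q 1) (q 2))
    (ρ := compactRadius q * kappa (compactRadius q) (q 1))]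
  · simp only [hp0, hp1, hp2, unitVec, Matrix.cons_val, Matrix.cons_val_zero, Matrix.cons_val_one]
    congr 1 <;> field_simp
  · simp only [hp0, hp1, hp2, unitVec, Matrix.cons_val, Matrix.cons_val_zero, Matrix.cons_val_one]
    linear_combination compactRadius q ^ 2 * hk2
      - compactRadius q ^ 2 * Real.sin (q 1) ^ 2 * h1

theorem isOpen_orbitSpace : IsOpen orbitSpace := by
  have h : orbitSpace = ((fun x : Coord3 => x 0) ⁻¹' Set.Ioi 0 ∩
      (fun x : Coord3 => x 1) ⁻¹' Set.Ioo 0 Real.pi) ∩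
      (fun x : Coord3 => x 2) ⁻¹' Set.Ioo 0 (4 * Real.pi) := by
    ext x; simp [orbitSpace, and_assoc]
  rw [h]
  exact ((isOpen_Ioi.preimage (continuous_apply 0)).inter
    (isOpen_Ioo.preimage (continuous_apply 1))).inter (isOpen_Ioo.preimage (continuous_apply 2))

/-- Factoring the length as `s κ` makes the square root and the divisions smooth, because `κ` never
vanishes. -/
theorem contDiffOn_skyrmeField (a b : Fin 2) :
    ContDiffOn ℝ (⊤ : ℕ∞) (fun q => skyrmeField q a b) orbitSpace := by
  have h0 : ContDiffOn ℝ (⊤ : ℕ∞) compactRadius orbitSpace := by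
    unfold compactRadius
    refine ContDiffOn.div (by fun_prop) (by fun_prop) fun q hq => ?_
    have := hq.1
    positivity
  have hk : ContDiffOn ℝ (⊤ : ℕ∞) (fun q : Coord3 => kappa (compactRadius q) (q 1)) orbitSpace := by
    unfold kappa
    refine ContDiffOn.sqrt (by fun_prop) fun q hq => (kappa_arg_pos ?_ _).ne'
    linarith [(compactRadius_mem hq).2]
  have hk0 : ∀ q ∈ orbitSpace, kappa (compactRadius q) (q 1) ≠ 0 := fun q hq =>
    (kappa_pos (by linarith [(compactRadius_mem hq).2]) _).ne'
  have hcos : ContDiffOn ℝ (⊤ : ℕ∞) (fun q : Coord3 =>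
      Real.cos (Real.pi * (compactRadius q * kappa (compactRadius q) (q 1)))) orbitSpace := by
    fun_prop
  have hsin : ContDiffOn ℝ (⊤ : ℕ∞) (fun q : Coord3 =>
      Real.sin (Real.pi * (compactRadius q * kappa (compactRadius q) (q 1)))) orbitSpace := by
    fun_prop
  have hn : ContDiffOn ℝ (⊤ : ℕ∞) (fun q : Coord3 =>
      Real.sin (q 1) / kappa (compactRadius q) (q 1)) orbitSpace :=
    ContDiffOn.div (by fun_prop) hk hk0
  have hn' : ContDiffOn ℝ (⊤ : ℕ∞) (fun q : Coord3 =>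
      -((2 - compactRadius q) * Real.cos (q 1)) / kappa (compactRadius q) (q 1)) orbitSpace :=
    ContDiffOn.div (by fun_prop) hk hk0
  refine ContDiffOn.congr ?_ fun q hq => by rw [skyrmeField_eq hq]
  have hof : ∀ {f : Coord3 → ℝ}, ContDiffOn ℝ (⊤ : ℕ∞) f orbitSpace →
      ContDiffOn ℝ (⊤ : ℕ∞) (fun q => (f q : ℂ)) orbitSpace := fun h =>
    Complex.ofRealCLM.contDiff.comp_contDiffOn h
  have hA := hof hcos
  have hB := hof ((hsin.mul hn).mul (show ContDiffOn ℝ (⊤ : ℕ∞) (fun q : Coord3 => Real.cos (q 2))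
    orbitSpace by fun_prop))
  have hC := hof ((hsin.mul hn).mul (show ContDiffOn ℝ (⊤ : ℕ∞) (fun q : Coord3 => Real.sin (q 2))
    orbitSpace by fun_prop))
  have hD := hof (hsin.mul hn')
  fin_cases a <;> fin_cases b
  · exact hA.add (contDiffOn_const.mul hD)
  · exact (contDiffOn_const.mul hB).add hC
  · exact (contDiffOn_const.mul hB).sub hC
  · exact hA.sub (contDiffOn_const.mul hD)

/-- The degree density in the coordinates `s = r / (r + 1)` and `θ`. -/
noncomputable def degreeDensity (s θ : ℝ) : ℝ :=
  Real.sin (Real.pi * (s * kappa s θ)) ^ 2 / kappa s θ ^ 2 * Real.sin θ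
    * ((2 - s) - s * Real.cos θ ^ 2)

/-- The three-form `Tr((U⁻¹ dU)³)` of a field which is axially symmetric in the target: here
`g` is the distance from the identity and `(n₁, n₂)` is the unit vector rotating at the rate `ω`. -/
theorem traceCube_of_axial {U : Coord3 → Matrix (Fin 2) (Fin 2) ℂ} {q : Coord3}
    {g n₁ n₂ : Coord3 → ℝ} {g' ω : Fin 3 → ℝ}
    (hU : U =ᶠ[nhds q] fun p => quatMatrix (Real.cos (g p)) (Real.sin (g p) * n₁ p * Real.cos (p 2))
      (Real.sin (g p) * n₁ p * Real.sin (p 2)) (Real.sin (g p) * n₂ p))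
    (hg : ∀ k, HasLineDerivAt ℝ g (g' k) q (partialVec k))
    (hn₁ : ∀ k, HasLineDerivAt ℝ n₁ (-n₂ q * ω k) q (partialVec k))
    (hn₂ : ∀ k, HasLineDerivAt ℝ n₂ (n₁ q * ω k) q (partialVec k))
    (hn : n₁ q ^ 2 + n₂ q ^ 2 = 1) (hg2 : g' 2 = 0) (hω2 : ω 2 = 0) :
    traceCube U q
      = ((-12 * (Real.sin (g q) ^ 2 * n₁ q * (g' 0 * ω 1 - g' 1 * ω 0)) : ℝ) : ℂ) := by
  have h00 : ∀ k : Fin 3, q + (0 : ℝ) • partialVec k = q := fun k => by simp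
  have hψ : ∀ k : Fin 3,
      HasLineDerivAt ℝ (fun p : Coord3 => p 2) ((partialVec k : Coord3) 2) q (partialVec k) :=
    fun k => by
      simpa [HasLineDerivAt] using
        ((hasDerivAt_id (0 : ℝ)).mul_const ((partialVec k : Coord3) 2)).const_add (q 2)
  have ha : ∀ k, HasLineDerivAt ℝ (fun p => Real.cos (g p)) (-Real.sin (g q) * g' k) q
      (partialVec k) := fun k => by
    have h := (hg k).cos
    rwa [h00] at h
  have hA : ∀ k, HasLineDerivAt ℝ (fun p => Real.sin (g p) * n₁ p)
      (Real.cos (g q) * g' k * n₁ q + Real.sin (g q) * (-n₂ q * ω k)) q (partialVec k) := fun k => by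
    have h := (hg k).sin.fun_mul (hn₁ k)
    rwa [h00] at h
  have hb : ∀ k, HasLineDerivAt ℝ (fun p => Real.sin (g p) * n₁ p * Real.cos (p 2))
      ((Real.cos (g q) * g' k * n₁ q + Real.sin (g q) * (-n₂ q * ω k)) * Real.cos (q 2)
        + Real.sin (g q) * n₁ q * (-Real.sin (q 2) * (partialVec k : Coord3) 2)) q
      (partialVec k) := fun k => by
    have h := HasDerivAt.fun_mul (hA k) (hψ k).cos
    simp only [h00] at h
    exact h
  have hc : ∀ k, HasLineDerivAt ℝ (fun p => Real.sin (g p) * n₁ p * Real.sin (p 2))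
      ((Real.cos (g q) * g' k * n₁ q + Real.sin (g q) * (-n₂ q * ω k)) * Real.sin (q 2)
        + Real.sin (g q) * n₁ q * (Real.cos (q 2) * (partialVec k : Coord3) 2)) q
      (partialVec k) := fun k => by
    have h := HasDerivAt.fun_mul (hA k) (hψ k).sin
    simp only [h00] at h
    exact h
  have hd : ∀ k, HasLineDerivAt ℝ (fun p => Real.sin (g p) * n₂ p)
      (Real.cos (g q) * g' k * n₂ q + Real.sin (g q) * (n₁ q * ω k)) q (partialVec k) := fun k => by
    have h := (hg k).sin.fun_mul (hn₂ k)
    rwa [h00] at h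
  have e0 : (partialVec 0 : Coord3) 2 = 0 := by simp [partialVec]
  have e1 : (partialVec 1 : Coord3) 2 = 0 := by simp [partialVec]
  have e2 : (partialVec 2 : Coord3) 2 = 1 := by simp [partialVec]
  have h1 := Real.sin_sq_add_cos_sq (q 2)
  have h2 := Real.sin_sq_add_cos_sq (g q)
  rw [traceCube_eq_of_eventuallyEq hU ?_ ?_ ha hb hc hd]
  · congr 1
    rw [neg_mul (12 : ℝ), ← mul_neg]
    congr 1
    rw [Matrix.det_fin_three]
    simp only [Matrix.of_apply, Matrix.cons_val, e0, e1, e2, hg2, hω2]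
    generalize Real.sin (q 2) = s at h1 ⊢
    generalize Real.cos (q 2) = c at h1 ⊢
    generalize Real.sin (g q) = S at h2 ⊢
    generalize Real.cos (g q) = C at h2 ⊢
    generalize n₁ q = a at hn ⊢
    generalize n₂ q = b at hn ⊢
    -- Components of `U⁻¹dU` in the frame rotating with `ψ`; `k1`, `k2` rotate `X` and `Y` back by
    -- the angle `ψ`.
    have hX : ∀ g w : ℝ, C * (C * g * a + S * (-b * w)) - S * a * (-S * g)
        = g * a - S * C * b * w := fun g w => by linear_combination g * a * h2
    have hZ : ∀ g w : ℝ, C * (C * g * b + S * (a * w)) - S * b * (-S * g)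
        = g * b + S * C * a * w := fun g w => by linear_combination g * b * h2
    have hY : ∀ g w : ℝ, S * a * (C * g * b + S * (a * w)) - S * b * (C * g * a + S * (-b * w))
        = S ^ 2 * w := fun g w => by linear_combination S ^ 2 * w * hn
    have k1 : ∀ g w : ℝ, C * ((C * g * a + S * (-b * w)) * c + S * a * (-s * 0))
        - S * a * c * (-S * g) + S * a * s * (C * g * b + S * (a * w))
        - S * b * ((C * g * a + S * (-b * w)) * s + S * a * (c * 0))
        = c * (g * a - S * C * b * w) + s * (S ^ 2 * w) := fun g w => by
      linear_combination c * hX g w + s * hY g w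
    have k2 : ∀ g w : ℝ, C * ((C * g * a + S * (-b * w)) * s + S * a * (c * 0))
        - S * a * s * (-S * g) + S * b * ((C * g * a + S * (-b * w)) * c + S * a * (-s * 0))
        - S * a * c * (C * g * b + S * (a * w))
        = s * (g * a - S * C * b * w) - c * (S ^ 2 * w) := fun g w => by
      linear_combination s * hX g w - c * hY g w
    have k3 : ∀ g w : ℝ, C * (C * g * b + S * (a * w)) - S * b * (-S * g)
        + S * a * c * ((C * g * a + S * (-b * w)) * s + S * a * (c * 0))
        - S * a * s * ((C * g * a + S * (-b * w)) * c + S * a * (-s * 0))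
        = g * b + S * C * a * w := fun g w => by linear_combination hZ g w
    have k4 : C * (C * 0 * b + S * (a * 0)) - S * b * (-S * 0)
        + S * a * c * ((C * 0 * a + S * (-b * 0)) * s + S * a * (c * 1))
        - S * a * s * ((C * 0 * a + S * (-b * 0)) * c + S * a * (-s * 1))
        = (S * a) ^ 2 := by linear_combination (S * a) ^ 2 * h1
    rw [k1, k1, k2, k2, k3, k3, k4]
    generalize g' 0 = g0
    generalize g' 1 = g1
    generalize ω 0 = w0
    generalize ω 1 = w1
    linear_combination (S * a * (S * a * (S ^ 2 * w0 * (g1 * a - S * C * b * w1)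
        - (g0 * a - S * C * b * w0) * (S ^ 2 * w1))
      + (g0 * b + S * C * a * w0) * (C * (g1 * a - S * C * b * w1) - S * b * (S ^ 2 * w1))
      - (g1 * b + S * C * a * w1) * (C * (g0 * a - S * C * b * w0) - S * b * (S ^ 2 * w0)))) * h1
      - S ^ 2 * a * (g0 * w1 - g1 * w0) * ((S ^ 2 + C ^ 2) * hn + h2)
  · linear_combination h2 + Real.sin (g q) ^ 2 * n₁ q ^ 2 * h1 + Real.sin (g q) ^ 2 * hn
  · intro k
    linear_combination Real.sin (g q) * Real.cos (g q) * g' k * hn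
      + Real.sin (g q) * n₁ q * (Real.cos (g q) * g' k * n₁ q + Real.sin (g q) * (-n₂ q * ω k)) * h1

theorem traceCube_skyrmeField {q : Coord3} (hq : q ∈ orbitSpace) :
    traceCube skyrmeField q
      = ((-12 * Real.pi * (1 / (q 0 + 1) ^ 2 * degreeDensity (compactRadius q) (q 1)) : ℝ) : ℂ) := by
  obtain ⟨hs0, hs1⟩ := compactRadius_mem hq
  have hs2 : compactRadius q < 2 := by linarith
  have hr : q 0 + 1 ≠ 0 := by have := hq.1; positivity
  have hev : skyrmeField =ᶠ[nhds q] _ :=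
    Filter.eventuallyEq_of_mem (isOpen_orbitSpace.mem_nhds hq) fun p hp => skyrmeField_eq hp
  have h00 : ∀ k : Fin 3, q + (0 : ℝ) • partialVec k = q := fun k => by simp
  have hx : ∀ k j : Fin 3, HasDerivAt (fun t : ℝ => (q + t • (partialVec k : Coord3)) j)
      ((partialVec k : Coord3) j) 0 := fun k j => by
    simpa using ((hasDerivAt_id (0 : ℝ)).mul_const ((partialVec k : Coord3) j)).const_add (q j)
  have hS : ∀ k : Fin 3, HasDerivAt (fun t : ℝ => compactRadius (q + t • partialVec k))
      ((partialVec k : Coord3) 0 / (q 0 + 1) ^ 2) 0 := by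
    intro k
    have h := (hx k 0).fun_div ((hx k 0).add_const 1) (by rw [h00]; exact hr)
    refine h.congr_deriv ?_
    rw [h00]
    congr 1
    ring
  have hs2' : ∀ k : Fin 3, compactRadius (q + (0 : ℝ) • partialVec k) < 2 := fun k => by rwa [h00]
  have hg := fun k => (((hS k).fun_mul ((hS k).kappa (hx k 1) (hs2' k))).const_mul Real.pi)
  have hn := fun k => hasDerivAt_sin_div_kappa (hS k) (hx k 1) (hs2' k)
  have hn' := fun k => hasDerivAt_cos_div_kappa (hS k) (hx k 1) (hs2' k)
  simp only [h00] at hg hn hn'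
  have hk := (kappa_pos hs2 (q 1)).ne'
  have hk2 := kappa_sq hs2 (q 1)
  have e00 : (partialVec 0 : Coord3) 0 = 1 := by simp [partialVec]
  have e01 : (partialVec 0 : Coord3) 1 = 0 := by simp [partialVec]
  have e10 : (partialVec 1 : Coord3) 0 = 0 := by simp [partialVec]
  have e11 : (partialVec 1 : Coord3) 1 = 1 := by simp [partialVec]
  have e20 : (partialVec 2 : Coord3) 0 = 0 := by simp [partialVec]
  have e21 : (partialVec 2 : Coord3) 1 = 0 := by simp [partialVec]
  rw [traceCube_of_axial (g := fun p => Real.pi * (compactRadius p * kappa (compactRadius p) (p 1)))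
    (n₁ := fun p => Real.sin (p 1) / kappa (compactRadius p) (p 1))
    (n₂ := fun p => -((2 - compactRadius p) * Real.cos (p 1)) / kappa (compactRadius p) (p 1))
    hev hg (fun k => (hn k).congr_deriv (by rw [neg_div, neg_neg])) hn' ?_ ?_ ?_]
  · congr 1
    rw [mul_assoc (-12)]
    congr 1
    simp only [e00, e01, e10, e11, degreeDensity]
    have h1 := Real.sin_sq_add_cos_sq (q 1)
    generalize Real.sin (Real.pi * (compactRadius q * kappa (compactRadius q) (q 1))) = S
    generalize kappa (compactRadius q) (q 1) = k at hk hk2 ⊢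
    generalize compactRadius q = s at hk2 ⊢
    generalize Real.sin (q 1) = y at h1 hk2 ⊢
    generalize Real.cos (q 1) = x at h1 hk2 ⊢
    -- The Jacobian `ρₛ ω_θ - ρ_θ ωₛ` comes with a numerator divisible by `κ²`, which lowers the
    -- power of `κ` in the density.
    have key : (2 - s) * k ^ 2 - s * (2 - s) ^ 2 * x ^ 2 - s * (1 - (2 - s) ^ 2) * y ^ 2 * x ^ 2
        = k ^ 2 * ((2 - s) - s * x ^ 2) := by
      rw [hk2]
      linear_combination s * (2 - s) ^ 2 * x ^ 2 * h1
    have hR : S ^ 2 / k ^ 2 * y * ((2 - s) - s * x ^ 2)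
        = S ^ 2 / k ^ 4 * y * ((2 - s) * k ^ 2 - s * (2 - s) ^ 2 * x ^ 2
          - s * (1 - (2 - s) ^ 2) * y ^ 2 * x ^ 2) := by
      rw [key]
      field_simp
    rw [hR]
    field_simp
    ring
  · field_simp
    rw [hk2]
  · simp [e20, e21]
  · simp [e20, e21]

/-! ### Change of variables to a bounded box -/

/-- The map `(r, θ, ψ) ↦ (r / (r + 1), θ, ψ)`. -/
noncomputable def compactify (q : Coord3) : Coord3 := ![compactRadius q, q 1, q 2]

/-- The derivative of `compactify`. -/
noncomputable def compactifyDeriv (q : Coord3) : Coord3 →L[ℝ] Coord3 :=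
  ContinuousLinearMap.pi ![(1 / (q 0 + 1) ^ 2) • ContinuousLinearMap.proj 0,
    ContinuousLinearMap.proj 1, ContinuousLinearMap.proj 2]

theorem det_compactifyDeriv (q : Coord3) : (compactifyDeriv q).det = 1 / (q 0 + 1) ^ 2 := by
  rw [ContinuousLinearMap.det, ← LinearMap.det_toMatrix', Matrix.det_fin_three]
  simp [LinearMap.toMatrix'_apply, compactifyDeriv]

theorem hasFDerivAt_compactify {q : Coord3} (hq : q ∈ orbitSpace) :
    HasFDerivAt compactify (compactifyDeriv q) q := by
  have hr : q 0 + 1 ≠ 0 := by have := hq.1; positivity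
  refine hasFDerivAt_pi.2 fun i => ?_
  have hp : ∀ j, HasFDerivAt (fun p : Coord3 => p j) (ContinuousLinearMap.proj j : Coord3 →L[ℝ] ℝ) q :=
    fun j => hasFDerivAt_apply j q
  fin_cases i
  · have h : HasDerivAt (fun r : ℝ => r / (r + 1)) (1 / (q 0 + 1) ^ 2) (q 0) := by
      refine ((hasDerivAt_id (q 0)).fun_div ((hasDerivAt_id (q 0)).add_const 1) hr).congr_deriv ?_
      simp
    exact h.comp_hasFDerivAt q (hp 0)
  · exact hp 1
  · exact hp 2

/-- The upper corner of the box `compactify '' orbitSpace`. -/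
noncomputable def boxCorner : Coord3 := ![1, Real.pi, 4 * Real.pi]

theorem injOn_compactify : Set.InjOn compactify orbitSpace := by
  intro p hp q hq h
  have hp0 := hp.1
  have hq0 := hq.1
  have h0 := congrFun h 0
  have h1 := congrFun h 1
  have h2 := congrFun h 2
  simp only [compactify, compactRadius, Matrix.cons_val] at h0 h1 h2
  rw [div_eq_div_iff (by positivity) (by positivity)] at h0
  ext i
  fin_cases i
  · show p 0 = q 0
    linarith
  · exact h1
  · exact h2

theorem image_compactify :
    compactify '' orbitSpace = Set.univ.pi fun i => Set.Ioo ((0 : Coord3) i) (boxCorner i) := by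
  ext p
  simp only [Set.mem_image, Set.mem_univ_pi]
  constructor
  · rintro ⟨q, hq, rfl⟩ i
    fin_cases i
    · exact compactRadius_mem hq
    · exact hq.2.1
    · exact hq.2.2
  · intro h
    have h0 : 0 < p 0 ∧ p 0 < 1 := h 0
    have h3 : (1 - p 0) ≠ 0 := by linarith [h0.2]
    refine ⟨![p 0 / (1 - p 0), p 1, p 2], ⟨div_pos h0.1 (by linarith [h0.2]), h 1, h 2⟩, ?_⟩
    ext i
    fin_cases i
    · simp [compactify, compactRadius]
      field_simp
      ring
    · rfl
    · rfl

/-! ### The integral by the divergence theorem -/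

/-- The antiderivative of `sin²(πρ)` vanishing at `0`. -/
noncomputable def sinSqPrimitive (ρ : ℝ) : ℝ :=
  ρ / 2 - Real.sin (2 * Real.pi * ρ) / (4 * Real.pi)

theorem hasDerivAt_sinSqPrimitive (ρ : ℝ) :
    HasDerivAt sinSqPrimitive (Real.sin (Real.pi * ρ) ^ 2) ρ := by
  refine (((hasDerivAt_id ρ).div_const 2).fun_sub
    ((((hasDerivAt_id ρ).const_mul (2 * Real.pi)).sin).div_const (4 * Real.pi))).congr_deriv ?_
  have h : Real.cos (2 * Real.pi * ρ) = 1 - 2 * Real.sin (Real.pi * ρ) ^ 2 := by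
    rw [mul_assoc, Real.cos_two_mul, Real.cos_sq']; ring
  simp only [id, h]
  field_simp
  ring

/-- The radial component of a vector field with divergence `-degreeDensity`. -/
noncomputable def radialFlux (s θ : ℝ) : ℝ :=
  -(sinSqPrimitive (s * kappa s θ) * ((2 - s) * Real.sin θ) / kappa s θ ^ 3)

/-- The polar component of a vector field with divergence `-degreeDensity`. -/
noncomputable def polarFlux (s θ : ℝ) : ℝ :=
  sinSqPrimitive (s * kappa s θ) * (Real.cos θ * Real.sin θ ^ 2) / kappa s θ ^ 3

theorem hasDerivAt_radialFlux {s : ℝ} (hs : s < 2) (θ : ℝ) :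
    HasDerivAt (fun u => radialFlux u θ)
      (-(Real.sin (Real.pi * (s * kappa s θ)) ^ 2 * (2 - s) * Real.sin θ
          * (kappa s θ ^ 2 - s * (2 - s) * Real.cos θ ^ 2) / kappa s θ ^ 4)
        + sinSqPrimitive (s * kappa s θ) * Real.sin θ
          * (kappa s θ ^ 2 - 3 * (2 - s) ^ 2 * Real.cos θ ^ 2) / kappa s θ ^ 5) s := by
  have hk := (kappa_pos hs θ).ne'
  have hκ := (hasDerivAt_id s).kappa (hasDerivAt_const s θ) hs
  have hG := (hasDerivAt_sinSqPrimitive (s * kappa s θ)).comp s ((hasDerivAt_id s).fun_mul hκ)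
  refine ((hG.fun_mul (((hasDerivAt_id s).const_sub 2).mul_const (Real.sin θ))).fun_div
    (hκ.fun_pow 3) (pow_ne_zero 3 hk)).fun_neg.congr_deriv ?_
  simp only [id, Function.comp]
  field_simp
  push_cast
  ring

theorem hasDerivAt_polarFlux {s : ℝ} (hs : s < 2) (θ : ℝ) :
    HasDerivAt (fun u => polarFlux s u)
      (Real.sin (Real.pi * (s * kappa s θ)) ^ 2 * s * (1 - (2 - s) ^ 2) * Real.sin θ ^ 3
          * Real.cos θ ^ 2 / kappa s θ ^ 4
        + sinSqPrimitive (s * kappa s θ) * Real.sin θ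
          * ((2 * Real.cos θ ^ 2 - Real.sin θ ^ 2) * kappa s θ ^ 2
            - 3 * (1 - (2 - s) ^ 2) * Real.sin θ ^ 2 * Real.cos θ ^ 2) / kappa s θ ^ 5) θ := by
  have hk := (kappa_pos hs θ).ne'
  have hκ := (hasDerivAt_const θ s).kappa (hasDerivAt_id θ) hs
  have hG := (hasDerivAt_sinSqPrimitive (s * kappa s θ)).comp θ
    ((hasDerivAt_const θ s).fun_mul hκ)
  refine ((hG.fun_mul ((Real.hasDerivAt_cos θ).fun_mul ((Real.hasDerivAt_sin θ).fun_pow 2))).fun_div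
    (hκ.fun_pow 3) (pow_ne_zero 3 hk)).congr_deriv ?_
  simp only [id, Function.comp]
  field_simp
  push_cast
  ring

/-- The fluxes are `-G n₁ω_θ` and `G n₁ωₛ`, so their divergence is minus the coefficient of `d(G
n₁ω)`. In the proof, `e1` is the closedness of `n₁ω`, which removes the terms in `G`; `e2`
identifies the rest. -/
theorem deriv_radialFlux_add_deriv_polarFlux {s : ℝ} (hs : s < 2) (θ : ℝ) :
    deriv (fun u => radialFlux u θ) s + deriv (fun u => polarFlux s u) θ = -degreeDensity s θ := by
  rw [(hasDerivAt_radialFlux hs θ).deriv, (hasDerivAt_polarFlux hs θ).deriv, degreeDensity]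
  have hk := (kappa_pos hs θ).ne'
  have hk2 := kappa_sq hs θ
  have h1 := Real.sin_sq_add_cos_sq θ
  generalize kappa s θ = k at *
  generalize Real.sin (Real.pi * (s * k)) = S
  generalize sinSqPrimitive (s * k) = G
  generalize Real.sin θ = y at *
  generalize Real.cos θ = x at *
  have e1 : k ^ 2 - 3 * (2 - s) ^ 2 * x ^ 2 + ((2 * x ^ 2 - y ^ 2) * k ^ 2
      - 3 * (1 - (2 - s) ^ 2) * y ^ 2 * x ^ 2) = 0 := by
    rw [hk2]
    linear_combination (2 * (2 - s) ^ 2 * x ^ 2 - y ^ 2) * h1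
  have e2 : (2 - s) * (k ^ 2 - s * (2 - s) * x ^ 2) - s * (1 - (2 - s) ^ 2) * y ^ 2 * x ^ 2
      = k ^ 2 * ((2 - s) - s * x ^ 2) := by
    rw [hk2]
    linear_combination s * (2 - s) ^ 2 * x ^ 2 * h1
  have e3 : S ^ 2 / k ^ 2 * y * ((2 - s) - s * x ^ 2)
      = S ^ 2 / k ^ 4 * y * (k ^ 2 * ((2 - s) - s * x ^ 2)) := by field_simp
  rw [e3, ← e2]
  linear_combination G * y / k ^ 5 * e1

/-- The flux through the boundary of the box. -/
noncomputable def flux (i : Fin 3) (p : Coord3) : ℝ :=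
  ![radialFlux (p 0) (p 1), polarFlux (p 0) (p 1), 0] i

theorem continuous_kappa : Continuous fun p : Coord3 => kappa (p 0) (p 1) := by
  unfold kappa
  fun_prop

theorem lt_two_of_mem_box {p : Coord3} (hp : p ∈ Set.Icc 0 boxCorner) : p 0 < 2 := by
  have h : p 0 ≤ 1 := hp.2 0
  linarith

theorem differentiableAt_flux (i : Fin 3) {p : Coord3} (hp : p 0 < 2) :
    DifferentiableAt ℝ (flux i) p := by
  have hκ : DifferentiableAt ℝ (fun p : Coord3 => kappa (p 0) (p 1)) p := by
    unfold kappa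
    exact DifferentiableAt.sqrt (by fun_prop) (kappa_arg_pos hp _).ne'
  have hk := (kappa_pos hp (p 1)).ne'
  have hG : DifferentiableAt ℝ (fun p : Coord3 => sinSqPrimitive (p 0 * kappa (p 0) (p 1))) p := by
    unfold sinSqPrimitive
    fun_prop
  fin_cases i
  · change DifferentiableAt ℝ (fun p : Coord3 => radialFlux (p 0) (p 1)) p
    unfold radialFlux
    fun_prop (disch := positivity)
  · change DifferentiableAt ℝ (fun p : Coord3 => polarFlux (p 0) (p 1)) p
    unfold polarFlux
    fun_prop (disch := positivity)
  · exact differentiableAt_const (0 : ℝ)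

theorem sum_fderiv_flux {p : Coord3} (hp : p 0 < 2) :
    ∑ i, fderiv ℝ (flux i) p (Pi.single i 1) = -degreeDensity (p 0) (p 1) := by
  have hd := fun i => differentiableAt_flux i hp
  rw [Fin.sum_univ_three, ← deriv_radialFlux_add_deriv_polarFlux hp]
  have h0 : fderiv ℝ (flux 0) p (Pi.single 0 1) = deriv (fun u => radialFlux u (p 1)) (p 0) := by
    rw [(hasDerivAt_radialFlux hp (p 1)).deriv, ← (hd 0).lineDeriv_eq_fderiv]
    refine HasLineDerivAt.lineDeriv ?_
    have hx : HasDerivAt (fun t : ℝ => p 0 + t) 1 0 := (hasDerivAt_id 0).const_add (p 0)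
    have h := (show HasDerivAt _ _ (p 0 + 0) by
      simpa using hasDerivAt_radialFlux hp (p 1)).comp (0 : ℝ) hx
    simpa [HasLineDerivAt, flux, Function.comp_def] using h
  have h1 : fderiv ℝ (flux 1) p (Pi.single 1 1) = deriv (fun u => polarFlux (p 0) u) (p 1) := by
    rw [(hasDerivAt_polarFlux hp (p 1)).deriv, ← (hd 1).lineDeriv_eq_fderiv]
    refine HasLineDerivAt.lineDeriv ?_
    have hx : HasDerivAt (fun t : ℝ => p 1 + t) 1 0 := (hasDerivAt_id 0).const_add (p 1)
    have h := (show HasDerivAt _ _ (p 1 + 0) by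
      simpa using hasDerivAt_polarFlux hp (p 1)).comp (0 : ℝ) hx
    simpa [HasLineDerivAt, flux, Function.comp_def] using h
  have h2 : fderiv ℝ (flux 2) p (Pi.single 2 1) = 0 := by
    have : flux 2 = fun _ => (0 : ℝ) := rfl
    rw [this]
    simp
  rw [h0, h1, h2, add_zero]

theorem continuousOn_degreeDensity :
    ContinuousOn (fun p : Coord3 => degreeDensity (p 0) (p 1)) (Set.Icc 0 boxCorner) := by
  have hk : ∀ p ∈ Set.Icc (0 : Coord3) boxCorner, kappa (p 0) (p 1) ^ 2 ≠ 0 := fun p hp =>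
    pow_ne_zero 2 (kappa_pos (lt_two_of_mem_box hp) _).ne'
  have hc := continuous_kappa
  unfold degreeDensity
  refine ContinuousOn.mul (ContinuousOn.mul (ContinuousOn.div ?_
    (hc.pow 2).continuousOn hk) ?_) ?_ <;> fun_prop

theorem integrableOn_degreeDensity :
    IntegrableOn (fun p : Coord3 => degreeDensity (p 0) (p 1)) (Set.Icc 0 boxCorner) :=
  continuousOn_degreeDensity.integrableOn_compact isCompact_Icc

theorem boxCorner_nonneg : (0 : Coord3) ≤ boxCorner := by
  intro i
  have := Real.pi_pos
  fin_cases i <;> simp [boxCorner] <;> positivity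

theorem integral_box_sin :
    ∫ x in Set.Icc ((0 : Coord3) ∘ (0 : Fin 3).succAbove) (boxCorner ∘ (0 : Fin 3).succAbove),
      -(Real.sin (x 0) / 2) = -(4 * Real.pi) := by
  rw [← Set.pi_univ_Icc, volume_pi, Measure.restrict_pi_pi]
  have h := integral_fintype_prod_eq_prod (ι := Fin 2) (𝕜 := ℝ) (E := fun _ => ℝ)
    (f := ![fun t => -(Real.sin t / 2), fun _ => 1])
    (μ := fun i => volume.restrict (Set.Icc (((0 : Coord3) ∘ (0 : Fin 3).succAbove) i)
      ((boxCorner ∘ (0 : Fin 3).succAbove) i)))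
  have h0 : ∫ t in Set.Icc 0 Real.pi, -(Real.sin t / 2) = -1 := by
    rw [integral_Icc_eq_integral_Ioc, ← intervalIntegral.integral_of_le Real.pi_pos.le,
      intervalIntegral.integral_neg, intervalIntegral.integral_div, integral_sin]
    simp
  have h1 : ∫ _ in Set.Icc 0 (4 * Real.pi), (1 : ℝ) = 4 * Real.pi := by
    simp [Real.pi_pos.le]
  rw [Fin.prod_univ_two] at h
  simp only [Fin.prod_univ_two, Matrix.cons_val, mul_one] at h
  refine h.trans ?_
  change (∫ t in Set.Icc 0 Real.pi, -(Real.sin t / 2)) * (∫ _ in Set.Icc 0 (4 * Real.pi), (1 : ℝ)) = _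
  rw [h0, h1]
  ring

theorem integral_degreeDensity :
    ∫ p in Set.Icc (0 : Coord3) boxCorner, degreeDensity (p 0) (p 1) = 4 * Real.pi := by
  have hsum : Set.EqOn (fun p : Coord3 => ∑ i, fderiv ℝ (flux i) p (Pi.single i 1))
      (fun p => -degreeDensity (p 0) (p 1)) (Set.Icc 0 boxCorner) := fun p hp =>
    sum_fderiv_flux (lt_two_of_mem_box hp)
  -- The other faces contribute nothing: `G(0) = 0` at `s = 0`, `sin θ = 0` at `θ = 0, π`, and there
  -- is no flux along `ψ`.
  have h := integral_divergence_of_hasFDerivAt_off_countable' 0 boxCorner boxCorner_nonneg flux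
    (fun i => fderiv ℝ (flux i)) ∅ Set.countable_empty
    (fun i p hp => (differentiableAt_flux i (lt_two_of_mem_box hp)).continuousAt.continuousWithinAt)
    (fun p hp i => (differentiableAt_flux i (lt_two_of_mem_box
      ⟨fun j => (hp.1 j trivial).1.le, fun j => (hp.1 j trivial).2.le⟩)).hasFDerivAt)
    (integrableOn_degreeDensity.neg.congr_fun hsum.symm measurableSet_Icc)
  rw [setIntegral_congr_fun measurableSet_Icc hsum, integral_neg] at h
  have f0 : ∀ x : Fin 2 → ℝ, flux 0 ((0 : Fin 3).insertNth (boxCorner 0) x)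
      = -(Real.sin (x 0) / 2) := by
    intro x
    -- At `s = 1`, that is `r = ∞`, the vector `F` has length one and `U` tends to `-1`.
    have hk : kappa 1 (x 0) = 1 := by
      rw [kappa, show (2 - 1 : ℝ) = 1 by norm_num, one_pow, one_mul, Real.sin_sq_add_cos_sq,
        Real.sqrt_one]
    have h1 : sinSqPrimitive 1 = 1 / 2 := by simp [sinSqPrimitive]
    change radialFlux 1 (x 0) = _
    rw [radialFlux, hk, mul_one, h1]
    ring
  have b0 : ∀ x : Fin 2 → ℝ, flux 0 ((0 : Fin 3).insertNth ((0 : Coord3) 0) x) = 0 := by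
    intro x
    change radialFlux 0 (x 0) = _
    simp [radialFlux, sinSqPrimitive]
  have f1 : ∀ x : Fin 2 → ℝ, flux 1 ((1 : Fin 3).insertNth (boxCorner 1) x) = 0 := by
    intro x
    change polarFlux (x 0) Real.pi = _
    simp [polarFlux]
  have b1 : ∀ x : Fin 2 → ℝ, flux 1 ((1 : Fin 3).insertNth ((0 : Coord3) 1) x) = 0 := by
    intro x
    change polarFlux (x 0) 0 = _
    simp [polarFlux]
  have f2 : ∀ p, flux 2 p = 0 := fun _ => rfl
  rw [Fin.sum_univ_three] at h
  simp only [f0, b0, f1, b1, f2, integral_zero, sub_zero, add_zero] at h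
  rw [integral_box_sin] at h
  linarith

theorem box_ae_eq_Icc :
    (Set.univ.pi fun i => Set.Ioo ((0 : Coord3) i) (boxCorner i))
      =ᵐ[(volume : Measure Coord3)] Set.Icc 0 boxCorner :=
  Measure.univ_pi_Ioo_ae_eq_Icc

theorem integral_image_eq : ∫ q in orbitSpace,
    1 / (q 0 + 1) ^ 2 * degreeDensity (compactRadius q) (q 1) = 4 * Real.pi := by
  have h := integral_image_eq_integral_abs_det_fderiv_smul volume isOpen_orbitSpace.measurableSet
    (fun q hq => (hasFDerivAt_compactify hq).hasFDerivWithinAt) injOn_compactify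
    (fun p => degreeDensity (p 0) (p 1))
  rw [image_compactify, setIntegral_congr_set box_ae_eq_Icc,
    integral_degreeDensity] at h
  rw [h]
  refine integral_congr_ae (Filter.Eventually.of_forall fun q => ?_)
  simp only [det_compactifyDeriv, smul_eq_mul]
  rw [abs_of_nonneg (by positivity)]
  rfl

/-- The density is continuous on the compact box, and `1/(r+1)²` is exactly the Jacobian of the
compactification. -/
theorem integrableOn_orbitSpace : IntegrableOn (fun q : Coord3 =>
    1 / (q 0 + 1) ^ 2 * degreeDensity (compactRadius q) (q 1)) orbitSpace := by
  have h := integrableOn_image_iff_integrableOn_abs_det_fderiv_smul volume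
    isOpen_orbitSpace.measurableSet
    (fun q hq => (hasFDerivAt_compactify hq).hasFDerivWithinAt) injOn_compactify
    (fun p => degreeDensity (p 0) (p 1))
  rw [image_compactify] at h
  have h2 := h.1 (integrableOn_degreeDensity.congr_set_ae box_ae_eq_Icc)
  refine h2.congr_fun (fun q _ => ?_) isOpen_orbitSpace.measurableSet
  simp only [det_compactifyDeriv, smul_eq_mul]
  rw [abs_of_nonneg (by positivity)]
  rfl

theorem integrableOn_traceCube : IntegrableOn (traceCube skyrmeField) orbitSpace := by
  have h : IntegrableOn (fun q : Coord3 => ((-12 * Real.pi *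
      (1 / (q 0 + 1) ^ 2 * degreeDensity (compactRadius q) (q 1)) : ℝ) : ℂ)) orbitSpace :=
    (integrableOn_orbitSpace.const_mul (-12 * Real.pi)).ofReal
  exact h.congr_fun (fun _ hq => (traceCube_skyrmeField hq).symm) isOpen_orbitSpace.measurableSet

theorem degree_skyrmeField : degree skyrmeField = 2 := by
  rw [degree, setIntegral_congr_fun isOpen_orbitSpace.measurableSet
    (fun _ hq => traceCube_skyrmeField hq), integral_complex_ofReal, integral_const_mul,
    integral_image_eq]
  have hπ : (Real.pi : ℂ) ≠ 0 := by exact_mod_cast Real.pi_ne_zero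
  push_cast
  field_simp
  norm_num

end TaubNUT

theorem mainTheorem2 :
    -- the tetrad is orthonormal for the Taub-NUT metric, and the `ηⱼ` are left-invariant on `SU(2)`
    (∀ x ∈ TaubNUT.chart, ∀ v : TaubNUT.Coord4,
      ∑ a, (TaubNUT.tetrad a x v) ^ 2 = TaubNUT.metric x v) ∧
    (∀ x v : TaubNUT.Coord4, ∀ a b : Fin 2,
      HasDerivAt (fun s : ℝ => TaubNUT.eulerMap (x + s • v) a b)
        ((TaubNUT.eulerMap x * ∑ j, ((TaubNUT.eta j x v : ℝ) : ℂ) • TaubNUT.gen j) a b) 0) ∧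
    -- the self-dual spin connection exists and is unique
    (∃ γ, TaubNUT.IsSelfDualSpinConnection γ) ∧
    (∀ γ γ', TaubNUT.IsSelfDualSpinConnection γ → TaubNUT.IsSelfDualSpinConnection γ' →
      ∀ x ∈ TaubNUT.chart, ∀ i j, γ i j x = γ' i j x) ∧
    -- its holonomy along the orbits of `∂/∂φ` is the Skyrme field
    (∀ γ, TaubNUT.IsSelfDualSpinConnection γ →
      (∀ x ∈ TaubNUT.chart, ∀ i,
        TaubNUT.potentialComponent γ i x (TaubNUT.partialVec 2)
          = TaubNUT.profile i (x 0) * TaubNUT.unitVec i (x 1) (x 3)) ∧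
      (∀ q ∈ TaubNUT.orbitSpace,
        TaubNUT.IsHolonomy (TaubNUT.potential γ) q (TaubNUT.skyrmeField q))) ∧
    -- it is a smooth `SU(2)`-valued map of degree two
    (∀ q, TaubNUT.skyrmeField q ∈ Matrix.specialUnitaryGroup (Fin 2) ℂ) ∧
    (∀ a b : Fin 2, ContDiffOn ℝ (⊤ : ℕ∞) (fun q => TaubNUT.skyrmeField q a b)
      TaubNUT.orbitSpace) ∧
    MeasureTheory.IntegrableOn (TaubNUT.traceCube TaubNUT.skyrmeField) TaubNUT.orbitSpace ∧
    TaubNUT.degree TaubNUT.skyrmeField = 2 := by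
  refine ⟨fun x hx v => TaubNUT.sum_tetrad_sq hx v, TaubNUT.hasDerivAt_eulerMap,
    ⟨_, TaubNUT.isSelfDualSpinConnection_spinConnection⟩,
    fun γ γ' h h' x hx i j => h.unique h' hx i j,
    fun γ h => ⟨fun x hx i => h.potentialComponent_partialVec hx i, fun q hq => h.isHolonomy hq⟩,
    TaubNUT.skyrmeField_mem_specialUnitaryGroup, TaubNUT.contDiffOn_skyrmeField,
    TaubNUT.integrableOn_traceCube, TaubNUT.degree_skyrmeField⟩
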